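/- Let $N\ge 4$ be an integer (the inverse Planck constant, $2\pi\hbar=1/N$) and let $I\in\mathbb Z$. On tempered distributions on $\mathbb R$ let $(T_Q\psi)(x)=\psi(x-1)$ and $(T_P\psi)(x)=e^{2\pi iNx}\psi(x)$; for $\theta=(\theta_1,\theta_2)$ let $\mathcal H_T(\theta)=\{\psi: T_Q\psi=e^{i\theta_1}\psi,\ T_P\psi=e^{i\theta_2}\psi\}$, which depends only on the class of $\theta$ in the torus $T_\theta=(\mathbb R/2\pi\mathbb Z)^2$. A state of the cylinder with parameter $\theta_2\in\mathbb R$ is a distribution $$\psi=\sum_{n\in\mathbb Z}c_n\,\delta(x-q_n(\theta_2)),\qquad q_n(\theta_2)=\tfrac1N\Big(n+\tfrac{\theta_2}{2\pi}\Big),\qquad \sum_n|c_n|<\infty,$$ so that $T_P\psi=e^{i\theta_2}\psi$. Let $X_I$ be the space of maps $\theta_2\in\mathbb R\mapsto\psi_C(\theta_2)$ such that $\psi_C(\theta_2)$ is a state of the cylinder with parameter $\theta_2$ whose weights $(c_n(\theta_2))_n\in\ell^1(\mathbb Z)$ depend continuously on $\theta_2$, and such that for all $\theta_2$ $$\psi_C(\theta_2)\neq0,\qquad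 \psi_C(\theta_2+2\pi)=T_Q^{I}\,\psi_C(\theta_2),$$ with the topology of locally uniform convergence of the weights in $\ell^1(\mathbb Z)$. For $\psi_C\in X_I$ put $$\tilde\psi(\theta)=P_{\theta_1}\psi_C(\theta_2)=\sum_{n\in\mathbb Z}e^{-in\theta_1}\,T_Q^n\,\psi_C(\theta_2),\qquad\theta\in\mathbb R^2 .$$ Then: 1. The series converges in the space of tempered distributions for every $\psi_C\in X_I$ and every $\theta\in\mathbb R^2$. 2. For a generic $\psi_C\in X_I$ the projection vanishes nowhere: the set of $\psi_C\in X_I$ with $\tilde\psi(\theta)\neq0$ for all $\theta\in\mathbb R^2$ is open and dense in $X_I$. 3. For every $\psi_C$ in this set, $\tilde\psi$ is continuous and is a local section of a well-defined complex line bundle over $T_\theta$: the line $\mathbb C\,\tilde\psi(\theta)$ depends only on the class of $\theta$ in $T_\theta$, and these lines form a continuous complex line subbundle $L$ of $\mathcal H_T\to T_\theta$. The Chern index of $L$ is $I$. Here the Chern index is $\frac{i}{2\pi}\int_{T_\theta}F$, where $T_\theta$ is oriented by $d\theta_1\wedge d\theta_2$ and $F$ is the curvature form of a connection on $L$, smooth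 with respect to some smooth structure on the continuous line bundle $L$ (given by local frames with smooth transition functions); it does not depend on the choices. -/

import Mathlib

open scoped SchwartzMap ContDiff

noncomputable section

namespace TorusQuantum

/-! ### Translation operators on tempered distributions -/

/-- The function `x ↦ exp (2πi N x)`, i.e. `exp (i x / ħ)` with `2πħ = 1 / N`. -/
def phaseFun (N : ℕ) (x : ℝ) : ℂ := Complex.exp (2 * Real.pi * Complex.I * N * x)

theorem phaseFun_hasTemperateGrowth (N : ℕ) : (phaseFun N).HasTemperateGrowth := by
  have hsm : ContDiff ℝ ∞ (phaseFun N) := by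
    have h : ContDiff ℝ ∞ (fun x : ℝ => (x : ℂ)) := Complex.ofRealCLM.contDiff
    exact (contDiff_const.mul h).cexp
  have hd : ∀ n : ℕ, ∀ x : ℝ, iteratedDeriv n (phaseFun N) x
      = (2 * Real.pi * Complex.I * N) ^ n * phaseFun N x := by
    intro n
    induction n with
    | zero => intro x; simp
    | succ n ih =>
      intro x
      rw [iteratedDeriv_succ, funext ih]
      have h1 : HasDerivAt (fun y : ℝ => (2 * Real.pi * Complex.I * N : ℂ) * (y : ℂ))
          (2 * Real.pi * Complex.I * N * 1) x :=
        (Complex.ofRealCLM.hasDerivAt (x := x)).const_mul _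
      have h2 := (h1.cexp.const_mul ((2 * Real.pi * Complex.I * N : ℂ) ^ n)).deriv
      unfold phaseFun
      rw [h2]
      ring
  refine ⟨hsm, fun n => ⟨0, ‖(2 * Real.pi * Complex.I * N : ℂ) ^ n‖, fun x => ?_⟩⟩
  rw [norm_iteratedFDeriv_eq_norm_iteratedDeriv, hd, norm_mul]
  have : ‖phaseFun N x‖ = 1 := by
    have h : (2 * Real.pi * Complex.I * N * x : ℂ) = ((2 * Real.pi * N * x : ℝ) : ℂ) * Complex.I := by
      push_cast; ring
    rw [phaseFun, h, Complex.norm_exp_ofReal_mul_I]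
  simp [this]

/-- `T_Q`, the translation `(T_Q ψ)(x) = ψ(x - 1)` of tempered distributions:
`(T_Q ψ)(φ) = ψ(φ(· + 1))`. -/
def TQ : 𝓢'(ℝ, ℂ) ≃L[ℂ] 𝓢'(ℝ, ℂ) :=
  ContinuousLinearEquiv.equivOfInverse
    (PointwiseConvergenceCLM.precomp ℂ (SchwartzMap.compSubConstCLM ℂ (-1 : ℝ)))
    (PointwiseConvergenceCLM.precomp ℂ (SchwartzMap.compSubConstCLM ℂ (1 : ℝ)))
    (fun ψ => by
      ext φ
      change ψ (SchwartzMap.compSubConstCLM ℂ (-1) (SchwartzMap.compSubConstCLM ℂ 1 φ)) = ψ φ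
      simp)
    (fun ψ => by
      ext φ
      change ψ (SchwartzMap.compSubConstCLM ℂ 1 (SchwartzMap.compSubConstCLM ℂ (-1) φ)) = ψ φ
      simp)

/-- `T_P = exp (i q̂ / ħ)` with `2πħ = 1 / N`: multiplication by `exp (2πi N x)`, which translates
the (semiclassical) Fourier transform by one period. -/
def TP (N : ℕ) : 𝓢'(ℝ, ℂ) →L[ℂ] 𝓢'(ℝ, ℂ) :=
  TemperedDistribution.smulLeftCLM ℂ (phaseFun N)

/-! ### The Hilbert spaces of the torus and of the cylinder -/

/-- The torus `T_θ` of the parameters `(θ₁, θ₂)` modulo `2π`. -/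
abbrev ThetaTorus : Type := Real.Angle × Real.Angle

/-- The projection `ℝ² → T_θ`. -/
def toThetaTorus (θ : ℝ × ℝ) : ThetaTorus := ((θ.1 : Real.Angle), (θ.2 : Real.Angle))

/-- `H_T(θ₁, θ₂)`: the tempered distributions with `T_Q ψ = exp (iθ₁) ψ`, `T_P ψ = exp (iθ₂) ψ`. -/
def HT (N : ℕ) (t : ThetaTorus) : Submodule ℂ 𝓢'(ℝ, ℂ) :=
  Module.End.eigenspace (TQ : 𝓢'(ℝ, ℂ) →ₗ[ℂ] 𝓢'(ℝ, ℂ)) (t.1.toCircle : ℂ) ⊓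
    Module.End.eigenspace (TP N : 𝓢'(ℝ, ℂ) →ₗ[ℂ] 𝓢'(ℝ, ℂ)) (t.2.toCircle : ℂ)

/-- `H_C(θ₂)`: the tempered distributions with `T_P ψ = exp (iθ₂) ψ`. -/
def HC (N : ℕ) (θ₂ : ℝ) : Submodule ℂ 𝓢'(ℝ, ℂ) :=
  Module.End.eigenspace (TP N : 𝓢'(ℝ, ℂ) →ₗ[ℂ] 𝓢'(ℝ, ℂ)) (Complex.exp (θ₂ * Complex.I))

/-- The points `q_n = (n + θ₂ / 2π) / N` that support the states of `H_C(θ₂)`. -/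
def cylPoint (N : ℕ) (θ₂ : ℝ) (n : ℤ) : ℝ := ((n : ℝ) + θ₂ / (2 * Real.pi)) / N

/-- The Banach space `ℓ¹(ℤ)` of absolutely summable weights. -/
abbrev Weights : Type := lp (fun _ : ℤ => ℂ) 1

/-- The state `∑ₙ cₙ δ(x - q_n)` of the cylinder with weights `c`. -/
def cylState (N : ℕ) (θ₂ : ℝ) (c : Weights) : 𝓢'(ℝ, ℂ) :=
  ∑' n : ℤ, c n • TemperedDistribution.delta (cylPoint N θ₂ n)

/-- The series defining `cylState` converges in the space of tempered distributions. -/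
theorem hasSum_cylState (N : ℕ) (θ₂ : ℝ) (c : Weights) :
    HasSum (fun n : ℤ => c n • TemperedDistribution.delta (cylPoint N θ₂ n))
      (cylState N θ₂ c) := by
  have hc : Summable fun n : ℤ => ‖c n‖ := by
    have := (lp.memℓp c).summable (by simp)
    simpa using this
  let ev : ℤ → (BoundedContinuousFunction ℝ ℂ →L[ℂ] ℂ) := fun n =>
    BoundedContinuousFunction.evalCLM ℂ (cylPoint N θ₂ n)
  have hev : ∀ n, ‖ev n‖ ≤ 1 := fun n =>
    ContinuousLinearMap.opNorm_le_bound _ zero_le_one fun f => by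
      simpa [ev] using f.norm_coe_le_norm _
  have hS : Summable fun n => c n • ev n := by
    refine Summable.of_norm_bounded hc fun n => ?_
    rw [norm_smul]
    exact mul_le_of_le_one_right (norm_nonneg _) (hev n)
  obtain ⟨S, hS⟩ := hS
  let L : 𝓢'(ℝ, ℂ) := ContinuousLinearMap.toPointwiseConvergenceCLM ℂ (RingHom.id ℂ) 𝓢(ℝ, ℂ) ℂ
    (S ∘L SchwartzMap.toBoundedContinuousFunctionCLM ℂ ℝ ℂ)
  refine Summable.hasSum ⟨L, ?_⟩
  rw [HasSum, (PointwiseConvergenceCLM.isEmbedding_coeFn (RingHom.id ℂ) 𝓢(ℝ, ℂ) ℂ).tendsto_nhds_iff,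
    tendsto_pi_nhds]
  intro φ
  have h := hS.mapL (ContinuousLinearMap.apply ℂ ℂ
    (SchwartzMap.toBoundedContinuousFunctionCLM ℂ ℝ ℂ φ))
  rw [HasSum] at h
  refine h.congr fun s => ?_
  simp [ev, sum_apply]

/-- The states of the cylinder belong to `H_C(θ₂)`. -/
theorem cylState_mem_HC {N : ℕ} (hN : N ≠ 0) (θ₂ : ℝ) (c : Weights) :
    cylState N θ₂ c ∈ HC N θ₂ := by
  have h1 := (hasSum_cylState N θ₂ c).mapL (TP N)
  have h2 := (hasSum_cylState N θ₂ c).const_smul (Complex.exp (θ₂ * Complex.I))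
  have key : ∀ n : ℤ, TP N (c n • TemperedDistribution.delta (cylPoint N θ₂ n))
      = Complex.exp (θ₂ * Complex.I) • c n • TemperedDistribution.delta (cylPoint N θ₂ n) := by
    intro n
    have hph : phaseFun N (cylPoint N θ₂ n) = Complex.exp (θ₂ * Complex.I) := by
      have hN' : (N : ℂ) ≠ 0 := by exact_mod_cast hN
      have hpi : (Real.pi : ℂ) ≠ 0 := by exact_mod_cast Real.pi_ne_zero
      have : (2 * Real.pi * Complex.I * N * (cylPoint N θ₂ n : ℝ) : ℂ)
          = θ₂ * Complex.I + n * (2 * Real.pi * Complex.I) := by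
        rw [cylPoint]
        push_cast
        field_simp
        ring
      rw [phaseFun, this, Complex.exp_add, Complex.exp_int_mul_two_pi_mul_I, mul_one]
    ext φ
    have hφ : (TP N (TemperedDistribution.delta (cylPoint N θ₂ n))) φ
        = phaseFun N (cylPoint N θ₂ n) * φ (cylPoint N θ₂ n) := by
      simp [TP, SchwartzMap.smulLeftCLM_apply_apply (phaseFun_hasTemperateGrowth N)]
    rw [map_smul]
    change c n * (TP N (TemperedDistribution.delta (cylPoint N θ₂ n))) φ
      = Complex.exp (θ₂ * Complex.I) * (c n * φ (cylPoint N θ₂ n))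
    rw [hφ, hph]
    ring
  rw [funext key] at h1
  exact Module.End.mem_eigenspace_iff.2 (h1.unique h2)

/-- The projection `P_{θ₁} ψ = ∑ₙ exp (-i n θ₁) T_Qⁿ ψ`. -/
def projTheta (θ₁ : ℝ) (ψ : 𝓢'(ℝ, ℂ)) : 𝓢'(ℝ, ℂ) :=
  ∑' n : ℤ, Complex.exp (-(n * θ₁ * Complex.I)) • (TQ ^ n) ψ

/-! ### Periodic motions on the cylinder -/

/-- The continuous nonvanishing maps `θ₂ ↦ ψ_C(θ₂)`, `ψ_C(θ₂)` a state of the cylinder with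
parameter `θ₂`, such that `ψ_C(θ₂ + 2π) = T_Q^k ψ_C(θ₂)`. Such a map is given by its weights with
respect to the `δ(x - q_n(θ₂))`; the topology is that of locally uniform convergence
of the weights in `ℓ¹(ℤ)` (the compact-open topology). -/
abbrev CylMotion (N : ℕ) (k : ℤ) : Type :=
  {c : C(ℝ, Weights) // (∀ θ₂ : ℝ, cylState N θ₂ (c θ₂) ≠ 0) ∧
    ∀ θ₂ : ℝ, cylState N (θ₂ + 2 * Real.pi) (c (θ₂ + 2 * Real.pi))
      = (TQ ^ k) (cylState N θ₂ (c θ₂))}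

variable {N : ℕ} {k : ℤ}

/-- `ψ_C(θ₂)`. -/
def CylMotion.state (ψ : CylMotion N k) (θ₂ : ℝ) : 𝓢'(ℝ, ℂ) := cylState N θ₂ (ψ.1 θ₂)

/-- `ψ̃(θ) = P_{θ₁} ψ_C(θ₂)`. -/
def CylMotion.proj (ψ : CylMotion N k) (θ : ℝ × ℝ) : 𝓢'(ℝ, ℂ) := projTheta θ.1 (ψ.state θ.2)

/-! ### Line bundles over the torus and their Chern index -/

/-- A continuous complex line subbundle of `H_T → T_θ`: a family of lines `L t ⊆ H_T(t)`, spanned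
near each point by a continuous nonvanishing local section. -/
structure IsLineSubbundle (N : ℕ) (L : ThetaTorus → Submodule ℂ 𝓢'(ℝ, ℂ)) : Prop where
  le_HT : ∀ t, L t ≤ HT N t
  locally_spanned : ∀ t, ∃ U : Set ThetaTorus, IsOpen U ∧ t ∈ U ∧
    ∃ s : ThetaTorus → 𝓢'(ℝ, ℂ), ContinuousOn s U ∧
      ∀ u ∈ U, s u ≠ 0 ∧ L u = Submodule.span ℂ {s u}

/-- Smoothness on `U` of a function on the torus, read in the coordinates `(θ₁, θ₂)`. -/
def SmoothOn (f : ThetaTorus → ℂ) (U : Set ThetaTorus) : Prop :=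
  ContDiffOn ℝ ∞ (fun θ => f (toThetaTorus θ)) (toThetaTorus ⁻¹' U)

/-- The partial derivative `∂/∂θ₁` of a function on the torus. -/
def partial₁ (f : ThetaTorus → ℂ) (t : ThetaTorus) : ℂ :=
  deriv (fun r : ℝ => f (t.1 + (r : Real.Angle), t.2)) 0

/-- The partial derivative `∂/∂θ₂` of a function on the torus. -/
def partial₂ (f : ThetaTorus → ℂ) (t : ThetaTorus) : ℂ :=
  deriv (fun r : ℝ => f (t.1, t.2 + (r : Real.Angle))) 0

/-- A smooth structure with a smooth connection on the line bundle `L`: frames `s i` over an open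
cover `U i`, with smooth transition functions `g i j`, and the connection forms
`A i = a₁ i dθ₁ + a₂ i dθ₂` (that is, `∇ (s i) = A i ⊗ s i`), which satisfy
`A j = A i + dg / g`. The curvature `dA i = curv dθ₁ ∧ dθ₂` does not depend on `i`. -/
structure Connection (L : ThetaTorus → Submodule ℂ 𝓢'(ℝ, ℂ)) where
  ι : Type
  U : ι → Set ThetaTorus
  isOpen_U : ∀ i, IsOpen (U i)
  cover : ∀ t, ∃ i, t ∈ U i
  s : ι → ThetaTorus → 𝓢'(ℝ, ℂ)
  s_cont : ∀ i, ContinuousOn (s i) (U i)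
  s_ne_zero : ∀ i, ∀ t ∈ U i, s i t ≠ 0
  s_span : ∀ i, ∀ t ∈ U i, L t = Submodule.span ℂ {s i t}
  g : ι → ι → ThetaTorus → ℂ
  g_smooth : ∀ i j, SmoothOn (g i j) (U i ∩ U j)
  s_eq : ∀ i j, ∀ t ∈ U i ∩ U j, s j t = g i j t • s i t
  a₁ : ι → ThetaTorus → ℂ
  a₂ : ι → ThetaTorus → ℂ
  a₁_smooth : ∀ i, SmoothOn (a₁ i) (U i)
  a₂_smooth : ∀ i, SmoothOn (a₂ i) (U i)
  a₁_eq : ∀ i j, ∀ t ∈ U i ∩ U j, a₁ j t = a₁ i t + partial₁ (g i j) t / g i j t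
  a₂_eq : ∀ i j, ∀ t ∈ U i ∩ U j, a₂ j t = a₂ i t + partial₂ (g i j) t / g i j t
  curv : ThetaTorus → ℂ
  curv_eq : ∀ i, ∀ t ∈ U i, curv t = partial₁ (a₂ i) t - partial₂ (a₁ i) t

/-- `L` has Chern index `C`: the integral of the curvature of a connection on `L` satisfies
`C = (i / 2π) ∫ curv dθ₁ dθ₂`. (By Chern-Weil theory the integral does not depend on the choice of
the smooth structure and of the connection.) -/
def HasChernIndex (L : ThetaTorus → Submodule ℂ 𝓢'(ℝ, ℂ)) (C : ℤ) : Prop :=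
  ∃ D : Connection L,
    (C : ℂ) = Complex.I / (2 * Real.pi) *
      ∫ x in (0 : ℝ)..(2 * Real.pi), ∫ y in (0 : ℝ)..(2 * Real.pi), D.curv (toThetaTorus (x, y))

end TorusQuantum

end

/-!
In terms of weights, the projection is elementary. Writing `ψ_C(θ₂)` as `∑ cₙ δ(x - q_n)`, tested
against a Schwartz function `φ` the projection is `∑ₘ cₘ Φ(θ₁, q_m)`, with
`Φ(θ₁, x) = ∑ₙ exp (-i n θ₁) φ(x + n)` continuous and bounded by a seminorm of `φ`
(`norm_periodize_le`, `continuous_periodize`). This gives the convergence (`hasSum_projState`) and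
the joint continuity of `(ψ_C, θ) ↦ ψ̃(θ)` (`CylMotion.continuous_uncurry_proj`). Shifting the
summation index gives `ψ̃(θ₁ + 2π, θ₂) = ψ̃(θ)` and `ψ̃(θ₁, θ₂ + 2π) = exp (i k θ₁) ψ̃(θ)`
(`CylMotion.proj_add_int`), so the zeros of `ψ̃` are detected on a compact square, and the motions
without zeros form an open set.

Density is a count of dimensions. The coefficients of `ψ̃(θ)` at `q_0, …, q_{N - 1}` form a vector
of `ℂ^N`, of real dimension `2 N > 2`, and `θ` has two real parameters. The quasi-periodicity
condition reads `c(θ₂ + 2π) = shift (1 - k N) c(θ₂)` on weights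
(`cylState_add_two_pi_eq_iff`), and the shift is an isometry of `ℓ¹`. A motion is approximated
uniformly by one that is piecewise linear in `θ₂`, with equivariant nodes of finite support, for
which the coefficients are smooth in `θ₁`. A segment from `u` to `p` has a zero only if
`p(θ₁) = -r u(θ₁)` for some `θ₁`, `r`. For `p = p₀ + v` with `v ∈ ℂ^N` constant this confines `v`
to the image of the `C¹` map `(θ₁, r) ↦ -(p₀(θ₁) + r u(θ₁))` from `ℝ²` to `ℂ^N`, whose complement is
dense (`exists_generic_near`).
Choosing the even nodes first and then the odd ones, each odd node has only two such images
to avoid, and no compatibility condition remains around the circle (`exists_nodes`).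

The lines `ℂ ψ̃(θ)` descend to the torus with transition functions `exp (i k n θ₁)`. The form
`(i k θ₂ / 2π) dθ₁` changes by `i k dθ₁` under `θ₂ ↦ θ₂ + 2π`, hence defines a connection, of
constant curvature `-(i k / 2π) dθ₁ ∧ dθ₂`, whose integral over the torus is `-2π i k`: the Chern
index is `k` (`CylMotion.connection`, `CylMotion.hasChernIndex_line`).
-/

noncomputable section

namespace TorusQuantum

/-! ### Periodization of Schwartz functions -/

/-- The factor `exp (-i n θ)` with which the `n`-th translate enters `P_θ`. -/
def character (θ : ℝ) (n : ℤ) : ℂ := Complex.exp (-(n * θ * Complex.I))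

theorem norm_character (θ : ℝ) (n : ℤ) : ‖character θ n‖ = 1 := by
  have h : (-(n * θ * Complex.I) : ℂ) = ((-(n * θ) : ℝ) : ℂ) * Complex.I := by push_cast; ring
  rw [character, h, Complex.norm_exp_ofReal_mul_I]

theorem character_zero_right (θ : ℝ) : character θ 0 = 1 := by simp [character]

theorem character_add_two_pi (θ : ℝ) (n : ℤ) : character (θ + 2 * Real.pi) n = character θ n := by
  rw [character, character]
  refine Complex.exp_eq_exp_iff_exists_int.2 ⟨-n, ?_⟩
  push_cast
  ring

theorem contDiff_character (n : ℤ) : ContDiff ℝ ∞ fun θ => character θ n :=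
  ((contDiff_const.mul Complex.ofRealCLM.contDiff).mul contDiff_const).neg.cexp

/-- The seminorm `sup |φ| + sup |x² φ|`, which controls the quadratic decay of `φ`. -/
def decayBound (φ : 𝓢(ℝ, ℂ)) : ℝ := SchwartzMap.seminorm ℂ 0 0 φ + SchwartzMap.seminorm ℂ 2 0 φ

theorem decayBound_nonneg (φ : 𝓢(ℝ, ℂ)) : 0 ≤ decayBound φ :=
  add_nonneg (apply_nonneg _ _) (apply_nonneg _ _)

theorem norm_le_decayBound (φ : 𝓢(ℝ, ℂ)) (x : ℝ) : (1 + x ^ 2) * ‖φ x‖ ≤ decayBound φ := by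
  have h0 := SchwartzMap.norm_le_seminorm ℂ φ x
  have h2 := SchwartzMap.norm_pow_mul_le_seminorm ℂ φ 2 x
  rw [Real.norm_eq_abs, sq_abs] at h2
  rw [decayBound]
  linarith

/-- The summable majorant of the integer translates of a function of quadratic decay. -/
def translateMajorant (n : ℤ) : ℝ := 1 / (1 + (n : ℝ) ^ 2)

theorem translateMajorant_nonneg (n : ℤ) : 0 ≤ translateMajorant n := by
  rw [translateMajorant]; positivity

theorem summable_translateMajorant : Summable translateMajorant := by
  refine (Real.summable_one_div_int_pow.2 one_lt_two).of_norm_bounded_eventually ?_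
  filter_upwards [(Set.finite_singleton (0 : ℤ)).compl_mem_cofinite] with n hn
  have hn' : (n : ℝ) ≠ 0 := by exact_mod_cast hn
  rw [Real.norm_of_nonneg (translateMajorant_nonneg n), translateMajorant]
  have : 0 < (n : ℝ) ^ 2 := by positivity
  gcongr
  linarith

/-- Peetre's inequality `1 + n² ≤ 2 (1 + (x + n)²) (1 + x²)` transfers the decay of `φ` to its
translates. -/
theorem norm_translate_le (φ : 𝓢(ℝ, ℂ)) (x : ℝ) (n : ℤ) :
    ‖φ (x + n)‖ ≤ 2 * (1 + x ^ 2) * decayBound φ * translateMajorant n := by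
  have h := norm_le_decayBound φ (x + n)
  have hP : 1 + (n : ℝ) ^ 2 ≤ 2 * (1 + x ^ 2) * (1 + (x + n) ^ 2) := by
    nlinarith [sq_nonneg (x * (x + n)), sq_nonneg (2 * x + n), sq_nonneg (x + n), sq_nonneg x]
  rw [translateMajorant, mul_one_div, le_div_iff₀ (by positivity)]
  calc ‖φ (x + n)‖ * (1 + (n : ℝ) ^ 2)
      ≤ ‖φ (x + n)‖ * (2 * (1 + x ^ 2) * (1 + (x + n) ^ 2)) := by gcongr
    _ = 2 * (1 + x ^ 2) * ((1 + (x + n) ^ 2) * ‖φ (x + n)‖) := by ring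
    _ ≤ 2 * (1 + x ^ 2) * decayBound φ := by gcongr

theorem summable_norm_translate (φ : 𝓢(ℝ, ℂ)) (x : ℝ) : Summable fun n : ℤ => ‖φ (x + n)‖ :=
  .of_nonneg_of_le (fun _ => norm_nonneg _) (norm_translate_le φ x)
    (summable_translateMajorant.mul_left _)

/-- The constant in `tsum_norm_translate_le`. -/
def translateConst : ℝ := 4 * ∑' n, translateMajorant n

theorem translateConst_nonneg : 0 ≤ translateConst :=
  mul_nonneg (by norm_num) (tsum_nonneg translateMajorant_nonneg)

/-- The sum of the translates is a periodic function of `x`, whence the uniform bound. -/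
theorem tsum_norm_translate_le (φ : 𝓢(ℝ, ℂ)) (x : ℝ) :
    ∑' n : ℤ, ‖φ (x + n)‖ ≤ translateConst * decayBound φ := by
  have hper : ∑' n : ℤ, ‖φ (x + n)‖ = ∑' n : ℤ, ‖φ (Int.fract x + n)‖ := by
    rw [← (Equiv.addLeft ⌊x⌋).tsum_eq fun n : ℤ => ‖φ (Int.fract x + n)‖]
    refine tsum_congr fun n => ?_
    rw [Equiv.coe_addLeft, Int.cast_add, ← add_assoc, Int.fract_add_floor]
  have hf : Int.fract x ^ 2 ≤ 1 :=
    pow_le_one₀ (Int.fract_nonneg x) (Int.fract_lt_one x).le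
  have h4 : ∀ n : ℤ, ‖φ (Int.fract x + n)‖ ≤ 4 * decayBound φ * translateMajorant n := fun n => by
    refine (norm_translate_le φ _ n).trans ?_
    have := decayBound_nonneg φ
    have := translateMajorant_nonneg n
    gcongr
    linarith
  rw [hper]
  refine ((summable_norm_translate φ _).tsum_le_tsum h4
    (summable_translateMajorant.mul_left _)).trans (le_of_eq ?_)
  rw [tsum_mul_left, translateConst]
  ring

/-- The quasi-periodization `x ↦ ∑ₙ exp (-i n θ) φ(x + n)` of a Schwartz function, the transpose of
`P_θ` applied to `φ`. -/
def periodize (θ : ℝ) (φ : 𝓢(ℝ, ℂ)) (x : ℝ) : ℂ := ∑' n : ℤ, character θ n * φ (x + n)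

theorem summable_periodize (θ : ℝ) (φ : 𝓢(ℝ, ℂ)) (x : ℝ) :
    Summable fun n : ℤ => character θ n * φ (x + n) := by
  refine .of_norm ?_
  simpa [norm_character] using summable_norm_translate φ x

theorem norm_periodize_le (θ : ℝ) (φ : 𝓢(ℝ, ℂ)) (x : ℝ) :
    ‖periodize θ φ x‖ ≤ translateConst * decayBound φ := by
  refine (norm_tsum_le_tsum_norm ?_).trans ?_
  · simpa [norm_character] using summable_norm_translate φ x
  · simpa [norm_character] using tsum_norm_translate_le φ x

theorem continuous_periodize (φ : 𝓢(ℝ, ℂ)) :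
    Continuous fun y : ℝ × ℝ => periodize y.1 φ y.2 := by
  rw [continuous_iff_continuousAt]
  intro y
  -- Peetre's bound is uniform on strips `|x| < R`, so the series converges uniformly there
  obtain ⟨R, hR⟩ := exists_gt |y.2|
  have hS : IsOpen {z : ℝ × ℝ | |z.2| < R} :=
    isOpen_lt (continuous_abs.comp continuous_snd) continuous_const
  refine ContinuousOn.continuousAt (s := {z : ℝ × ℝ | |z.2| < R}) ?_ (hS.mem_nhds hR)
  refine continuousOn_tsum
    (u := fun n => 2 * (1 + R ^ 2) * decayBound φ * translateMajorant n) (fun n => ?_)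
    (summable_translateMajorant.mul_left _) fun n z hz => ?_
  · exact (((contDiff_character n).continuous.comp continuous_fst).mul
      (φ.continuous.comp (continuous_snd.add continuous_const))).continuousOn
  · rw [norm_mul, norm_character, one_mul]
    refine (norm_translate_le φ z.2 n).trans ?_
    have := decayBound_nonneg φ
    have := translateMajorant_nonneg n
    have : z.2 ^ 2 ≤ R ^ 2 := by
      rw [← sq_abs]
      exact pow_le_pow_left₀ (abs_nonneg _) (le_of_lt hz) 2
    gcongr

/-! ### The projection of a state of the cylinder -/

theorem summable_norm_weights (c : Weights) : Summable fun n : ℤ => ‖c n‖ := by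
  simpa using (lp.memℓp c).summable (by simp)

theorem norm_weights (c : Weights) : ‖c‖ = ∑' n : ℤ, ‖c n‖ := by
  simp [lp.norm_eq_tsum_rpow (p := 1) (by simp) c]

theorem hasSum_apply {ι : Type*} {f : ι → 𝓢'(ℝ, ℂ)} {L : 𝓢'(ℝ, ℂ)} :
    HasSum f L ↔ ∀ φ, HasSum (fun i => f i φ) (L φ) := by
  simp only [HasSum]
  rw [(PointwiseConvergenceCLM.isEmbedding_coeFn (RingHom.id ℂ) 𝓢(ℝ, ℂ) ℂ).tendsto_nhds_iff,
    tendsto_pi_nhds]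
  refine forall_congr' fun φ => Filter.tendsto_congr fun s => ?_
  simp

theorem hasSum_cylState_apply (N : ℕ) (θ₂ : ℝ) (c : Weights) (φ : 𝓢(ℝ, ℂ)) :
    HasSum (fun n => c n * φ (cylPoint N θ₂ n)) (cylState N θ₂ c φ) := by
  simpa using hasSum_apply.1 (hasSum_cylState N θ₂ c) φ

theorem TQ_zpow_apply (n : ℤ) (ψ : 𝓢'(ℝ, ℂ)) (φ : 𝓢(ℝ, ℂ)) :
    (TQ ^ n) ψ φ = ψ (SchwartzMap.compSubConstCLM ℂ (-(n : ℝ)) φ) := by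
  induction n generalizing ψ with
  | zero =>
    change ψ φ = _
    simp
  | succ n ih =>
    rw [zpow_add_one]
    change (TQ ^ (n : ℤ)) (TQ ψ) φ = _
    rw [ih]
    change ψ (SchwartzMap.compSubConstCLM ℂ (-1) (SchwartzMap.compSubConstCLM ℂ _ φ)) = _
    rw [SchwartzMap.compSubConstCLM_comp]
    push_cast
    ring_nf
  | pred n ih =>
    rw [zpow_sub_one]
    change (TQ ^ (-(n : ℤ))) (TQ⁻¹ ψ) φ = _
    rw [ih]
    change ψ (SchwartzMap.compSubConstCLM ℂ 1 (SchwartzMap.compSubConstCLM ℂ _ φ)) = _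
    rw [SchwartzMap.compSubConstCLM_comp]
    push_cast
    ring_nf

theorem hasSum_TQ_zpow_cylState (N : ℕ) (θ₂ : ℝ) (c : Weights) (n : ℤ) (φ : 𝓢(ℝ, ℂ)) :
    HasSum (fun m => c m * φ (cylPoint N θ₂ m + n)) ((TQ ^ n) (cylState N θ₂ c) φ) := by
  rw [TQ_zpow_apply]
  simpa using hasSum_cylState_apply N θ₂ c (SchwartzMap.compSubConstCLM ℂ (-(n : ℝ)) φ)

theorem summable_weights_mul {c : Weights} {f : ℤ → ℂ} {M : ℝ} (hf : ∀ n, ‖f n‖ ≤ M) :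
    Summable fun n => c n * f n := by
  refine .of_norm_bounded ((summable_norm_weights c).mul_right M) fun n => ?_
  rw [norm_mul]
  gcongr
  exact hf n

theorem norm_tsum_weights_mul_le {c : Weights} {f : ℤ → ℂ} {M : ℝ} (hf : ∀ n, ‖f n‖ ≤ M) :
    ‖∑' n, c n * f n‖ ≤ ‖c‖ * M := by
  rw [norm_weights, ← tsum_mul_right]
  refine tsum_of_norm_bounded ((summable_norm_weights c).mul_right M).hasSum fun n => ?_
  rw [norm_mul]
  gcongr
  exact hf n

/-- `P_{θ₁}` applied to the state with weights `c`, constructed as the functional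
`φ ↦ ∑ₘ cₘ (periodize θ₁ φ)(q_m)`. -/
def projState (N : ℕ) (θ : ℝ × ℝ) (c : Weights) : 𝓢'(ℝ, ℂ) :=
  ContinuousLinearMap.toPointwiseConvergenceCLM ℂ (RingHom.id ℂ) 𝓢(ℝ, ℂ) ℂ
    (SchwartzMap.mkCLMtoNormedSpace (𝕜 := ℂ) (σ := RingHom.id ℂ)
      (fun φ => ∑' m, c m * periodize θ.1 φ (cylPoint N θ.2 m))
      (fun φ χ => by
        have h : ∀ x, periodize θ.1 (φ + χ) x = periodize θ.1 φ x + periodize θ.1 χ x := fun x => by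
          rw [periodize, periodize, periodize, ← Summable.tsum_add (summable_periodize _ _ _)
            (summable_periodize _ _ _)]
          simp [mul_add]
        simp only [h, mul_add]
        exact (summable_weights_mul fun _ => norm_periodize_le _ _ _).tsum_add
          (summable_weights_mul fun _ => norm_periodize_le _ _ _))
      (fun a φ => by
        have h : ∀ x, periodize θ.1 (a • φ) x = a * periodize θ.1 φ x := fun x => by
          rw [periodize, periodize, ← tsum_mul_left]
          simp [mul_left_comm]
        simp only [h, mul_left_comm _ a, tsum_mul_left, RingHom.id_apply, smul_eq_mul])
      ⟨{(0, 0), (2, 0)}, ‖c‖ * translateConst * 2,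
        by have := translateConst_nonneg; positivity, fun φ => by
        refine (norm_tsum_weights_mul_le fun _ => norm_periodize_le _ _ _).trans ?_
        have hB : decayBound φ ≤ 2 * (({(0, 0), (2, 0)} : Finset (ℕ × ℕ)).sup
            (schwartzSeminormFamily ℂ ℝ ℂ)) φ := by
          have h0 : (schwartzSeminormFamily ℂ ℝ ℂ (0, 0)) φ ≤ _ :=
            Seminorm.le_finset_sup_apply (p := schwartzSeminormFamily ℂ ℝ ℂ)
              (s := {(0, 0), (2, 0)}) (x := φ) (i := (0, 0)) (by simp)
          have h2 : (schwartzSeminormFamily ℂ ℝ ℂ (2, 0)) φ ≤ _ :=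
            Seminorm.le_finset_sup_apply (p := schwartzSeminormFamily ℂ ℝ ℂ)
              (s := {(0, 0), (2, 0)}) (x := φ) (i := (2, 0)) (by simp)
          rw [SchwartzMap.schwartzSeminormFamily_apply] at h0 h2
          rw [decayBound]
          linarith
        have := translateConst_nonneg
        calc ‖c‖ * (translateConst * decayBound φ)
            ≤ ‖c‖ * (translateConst * (2 * (({(0, 0), (2, 0)} : Finset (ℕ × ℕ)).sup
              (schwartzSeminormFamily ℂ ℝ ℂ)) φ)) := by gcongr
          _ = _ := by ring⟩)

theorem projState_apply (N : ℕ) (θ : ℝ × ℝ) (c : Weights) (φ : 𝓢(ℝ, ℂ)) :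
    projState N θ c φ = ∑' m, c m * periodize θ.1 φ (cylPoint N θ.2 m) := rfl

theorem hasSum_projState (N : ℕ) (θ : ℝ × ℝ) (c : Weights) :
    HasSum (fun n : ℤ => Complex.exp (-(n * θ.1 * Complex.I)) • (TQ ^ n) (cylState N θ.2 c))
      (projState N θ c) := by
  rw [hasSum_apply]
  intro φ
  set f : ℤ × ℤ → ℂ := fun p => c p.1 * (character θ.1 p.2 * φ (cylPoint N θ.2 p.1 + p.2)) with hf
  have hnorm : ∀ p, ‖f p‖ = ‖c p.1‖ * ‖φ (cylPoint N θ.2 p.1 + p.2)‖ := fun p => by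
    simp [hf, norm_character]
  have hsum : Summable f := by
    refine .of_norm ((summable_prod_of_nonneg fun _ => norm_nonneg _).2 ⟨fun m => ?_, ?_⟩)
    · simpa only [hnorm] using (summable_norm_translate φ _).mul_left _
    · simp only [hnorm, tsum_mul_left]
      refine .of_nonneg_of_le (fun m => by positivity) (fun m => ?_)
        ((summable_norm_weights c).mul_right (translateConst * decayBound φ))
      gcongr
      exact tsum_norm_translate_le φ _
  -- the double series may be summed over the translates first, or over the points first
  have h1 : ∑' p, f p = projState N θ c φ := by
    rw [hsum.tsum_prod, projState_apply]
    simp only [hf, tsum_mul_left, periodize]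
  rw [← h1, ← (Equiv.prodComm ℤ ℤ).tsum_eq f]
  refine hsum.prod_symm.hasSum.prod_fiberwise fun n => ?_
  refine ((hasSum_TQ_zpow_cylState N θ.2 c n φ).mul_left (character θ.1 n)).congr_fun fun m => ?_
  simp only [hf, Prod.swap]
  ring

theorem projTheta_cylState (N : ℕ) (θ : ℝ × ℝ) (c : Weights) :
    projTheta θ.1 (cylState N θ.2 c) = projState N θ c :=
  (hasSum_projState N θ c).tsum_eq

/-! ### Weights and coefficients -/

theorem cylPoint_add_int {N : ℕ} (hN : N ≠ 0) (θ₂ : ℝ) (m n : ℤ) :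
    cylPoint N θ₂ m + n = cylPoint N θ₂ (m + n * N) := by
  have : (N : ℝ) ≠ 0 := by exact_mod_cast hN
  rw [cylPoint, cylPoint]
  push_cast
  field_simp
  ring

theorem cylPoint_add_two_pi (N : ℕ) (θ₂ : ℝ) (n : ℤ) :
    cylPoint N (θ₂ + 2 * Real.pi) n = cylPoint N θ₂ (n + 1) := by
  have : (2 * Real.pi) ≠ 0 := by positivity
  rw [cylPoint, cylPoint, add_div θ₂, div_self this]
  push_cast
  ring

/-- The points that support the states of `H_C(θ₂)` are separated by test functions. -/
theorem exists_schwartz_eq_single {N : ℕ} (hN : N ≠ 0) (θ₂ : ℝ) (j : ℤ) :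
    ∃ φ : 𝓢(ℝ, ℂ), φ (cylPoint N θ₂ j) = 1 ∧ ∀ l ≠ j, φ (cylPoint N θ₂ l) = 0 := by
  have hN' : (0 : ℝ) < N := by exact_mod_cast Nat.pos_of_ne_zero hN
  let f : ContDiffBump (cylPoint N θ₂ j) :=
    { rIn := 1 / (2 * N), rOut := 1 / N, rIn_pos := by positivity,
      rIn_lt_rOut := by gcongr; linarith }
  have hsm : ContDiff ℝ ∞ fun x => (f x : ℂ) := Complex.ofRealCLM.contDiff.comp f.contDiff
  have hcs : HasCompactSupport fun x => (f x : ℂ) :=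
    f.hasCompactSupport.comp_left (g := ((↑) : ℝ → ℂ)) Complex.ofReal_zero
  refine ⟨hcs.toSchwartzMap hsm, ?_, fun l hl => ?_⟩
  · have : f (cylPoint N θ₂ j) = 1 :=
      f.one_of_mem_closedBall (Metric.mem_closedBall_self (by positivity))
    simp [this]
  · have h1 : (1 : ℝ) ≤ |(l : ℝ) - j| := by exact_mod_cast Int.one_le_abs (sub_ne_zero.2 hl)
    have : f (cylPoint N θ₂ l) = 0 := by
      refine f.zero_of_le_dist ?_
      have : cylPoint N θ₂ l - cylPoint N θ₂ j = ((l : ℝ) - j) / N := by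
        rw [cylPoint, cylPoint]; ring
      rw [Real.dist_eq, this, abs_div, abs_of_pos hN']
      change 1 / (N : ℝ) ≤ _
      gcongr
    simp [this]

/-- The coefficient `∑ₙ exp (-i n θ) c_{j - n N}` of `δ(x - q_j)` in the projection `P_θ` of the
state with weights `c`. -/
def coef (N : ℕ) (θ : ℝ) (j : ℤ) (c : Weights) : ℂ := ∑' n : ℤ, character θ n * c (j - n * N)

theorem summable_coef {N : ℕ} (hN : N ≠ 0) (θ : ℝ) (j : ℤ) (c : Weights) :
    Summable fun n : ℤ => character θ n * c (j - n * N) := by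
  refine .of_norm ?_
  simp only [norm_mul, norm_character, one_mul]
  refine (summable_norm_weights c).comp_injective (i := fun n : ℤ => j - n * N) fun m n h => ?_
  simpa [hN] using h

theorem coef_add {N : ℕ} (hN : N ≠ 0) (θ : ℝ) (j : ℤ) (c d : Weights) :
    coef N θ j (c + d) = coef N θ j c + coef N θ j d := by
  rw [coef, coef, coef, ← (summable_coef hN θ j c).tsum_add (summable_coef hN θ j d)]
  simp [mul_add]

theorem coef_smul (N : ℕ) (θ : ℝ) (j : ℤ) (r : ℝ) (c : Weights) :
    coef N θ j (r • c) = r * coef N θ j c := by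
  rw [coef, coef, ← tsum_mul_left]
  simp [mul_left_comm]

theorem coef_zero (N : ℕ) (θ : ℝ) (j : ℤ) : coef N θ j 0 = 0 := by simp [coef]

theorem projState_ne_zero {N : ℕ} (hN : N ≠ 0) {θ : ℝ × ℝ} {c : Weights} {j : ℤ}
    (h : coef N θ.1 j c ≠ 0) : projState N θ c ≠ 0 := by
  obtain ⟨φ, h1, h0⟩ := exists_schwartz_eq_single hN θ.2 j
  have hT : ∀ n : ℤ, (TQ ^ n) (cylState N θ.2 c) φ = c (j - n * N) := fun n => by
    refine (hasSum_TQ_zpow_cylState N θ.2 c n φ).unique ?_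
    have := hasSum_single (f := fun m => c m * φ (cylPoint N θ.2 m + n)) (j - n * N) fun m hm => by
      rw [cylPoint_add_int hN, h0 _ fun h => hm (by linarith), mul_zero]
    simpa [cylPoint_add_int hN, h1] using this
  have hp : projState N θ c φ = coef N θ.1 j c := by
    rw [← (hasSum_apply.1 (hasSum_projState N θ c) φ).tsum_eq, coef]
    refine tsum_congr fun n => ?_
    rw [← hT]
    rfl
  intro h'
  rw [h'] at hp
  exact h hp.symm

/-- The translation `(shift a c)ₙ = c_{n + a}` of weights. -/
def shift (a : ℤ) : Weights →ₗᵢ[ℂ] Weights where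
  toFun c := ⟨fun n => c (n + a), memℓp_gen (by
    simpa [Function.comp_def] using
      (Equiv.addRight a).summable_iff.2 (summable_norm_weights c))⟩
  map_add' _ _ := rfl
  map_smul' _ _ := rfl
  norm_map' c := by
    rw [norm_weights, norm_weights]
    exact (Equiv.addRight a).tsum_eq fun n => ‖c n‖

theorem shift_apply (a : ℤ) (c : Weights) (n : ℤ) : shift a c n = c (n + a) := rfl

theorem shift_real_smul (a : ℤ) (r : ℝ) (c : Weights) : shift a (r • c) = r • shift a c := rfl

theorem shift_zero (c : Weights) : shift 0 c = c := by
  ext n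
  rw [shift_apply, add_zero]

theorem shift_shift (a b : ℤ) (c : Weights) : shift a (shift b c) = shift (a + b) c := by
  ext n
  simp only [shift_apply, add_assoc]

theorem coef_shift (N : ℕ) (θ : ℝ) (j a : ℤ) (c : Weights) :
    coef N θ j (shift a c) = coef N θ (j + a) c := by
  refine tsum_congr fun n => ?_
  rw [shift_apply, sub_add_eq_add_sub]

/-- In terms of the weights, `ψ_C(θ₂ + 2π) = T_Q^k ψ_C(θ₂)` is invariance up to a translation. -/
theorem cylState_add_two_pi_eq_iff {N : ℕ} (hN : N ≠ 0) (k : ℤ) (θ₂ : ℝ) (c d : Weights) :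
    cylState N (θ₂ + 2 * Real.pi) d = (TQ ^ k) (cylState N θ₂ c) ↔ d = shift (1 - k * N) c := by
  constructor
  · intro h
    ext n
    obtain ⟨φ, h1, h0⟩ := exists_schwartz_eq_single hN θ₂ (n + 1)
    have hl : cylState N (θ₂ + 2 * Real.pi) d φ = d n := by
      refine (hasSum_cylState_apply N _ d φ).unique ?_
      have := hasSum_single (f := fun m => d m * φ (cylPoint N (θ₂ + 2 * Real.pi) m)) n
        fun m hm => by rw [cylPoint_add_two_pi, h0 _ (by simpa using hm), mul_zero]
      simpa [cylPoint_add_two_pi, h1] using this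
    have hr : (TQ ^ k) (cylState N θ₂ c) φ = c (n + (1 - k * N)) := by
      refine (hasSum_TQ_zpow_cylState N θ₂ c k φ).unique ?_
      have := hasSum_single (f := fun m => c m * φ (cylPoint N θ₂ m + k)) (n + (1 - k * N))
        fun m hm => by rw [cylPoint_add_int hN, h0 _ fun h => hm (by linarith), mul_zero]
      have he : n + (1 - k * N) + k * N = n + 1 := by ring
      simpa only [cylPoint_add_int hN, he, h1, mul_one] using this
    rw [shift_apply, ← hl, ← hr, h]
  · rintro rfl
    ext φ
    refine (hasSum_cylState_apply N _ _ φ).unique ?_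
    rw [← (Equiv.addRight (k * N - 1)).hasSum_iff]
    refine (hasSum_TQ_zpow_cylState N θ₂ c k φ).congr_fun fun m => ?_
    have e1 : m + (k * N - 1) + (1 - k * N) = m := by ring
    have e2 : m + (k * N - 1) + 1 = m + k * N := by ring
    simp only [Function.comp, Equiv.coe_addRight, shift_apply, cylPoint_add_two_pi,
      cylPoint_add_int hN, e1, e2]

/-! ### Equivariance of the projection -/

theorem TP_apply (N : ℕ) (ψ : 𝓢'(ℝ, ℂ)) (φ : 𝓢(ℝ, ℂ)) :
    TP N ψ φ = ψ (SchwartzMap.smulLeftCLM ℂ (phaseFun N) φ) := rfl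

theorem phaseFun_add_int (N : ℕ) (x : ℝ) (n : ℤ) : phaseFun N (x + n) = phaseFun N x := by
  rw [phaseFun, phaseFun]
  refine Complex.exp_eq_exp_iff_exists_int.2 ⟨N * n, ?_⟩
  push_cast
  ring

theorem phaseFun_cylPoint {N : ℕ} (hN : N ≠ 0) (θ₂ : ℝ) (n : ℤ) :
    phaseFun N (cylPoint N θ₂ n) = Complex.exp (θ₂ * Complex.I) := by
  have hN' : (N : ℂ) ≠ 0 := by exact_mod_cast hN
  have hpi : (Real.pi : ℂ) ≠ 0 := by exact_mod_cast Real.pi_ne_zero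
  rw [phaseFun, cylPoint]
  refine Complex.exp_eq_exp_iff_exists_int.2 ⟨n, ?_⟩
  push_cast
  field_simp
  ring

theorem TP_projState {N : ℕ} (hN : N ≠ 0) (θ : ℝ × ℝ) (c : Weights) :
    TP N (projState N θ c) = Complex.exp (θ.2 * Complex.I) • projState N θ c := by
  ext φ
  change TP N (projState N θ c) φ = Complex.exp (θ.2 * Complex.I) * projState N θ c φ
  rw [TP_apply, projState_apply, projState_apply, ← tsum_mul_left]
  refine tsum_congr fun m => ?_
  have : periodize θ.1 (SchwartzMap.smulLeftCLM ℂ (phaseFun N) φ) (cylPoint N θ.2 m)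
      = Complex.exp (θ.2 * Complex.I) * periodize θ.1 φ (cylPoint N θ.2 m) := by
    rw [periodize, periodize, ← tsum_mul_left]
    refine tsum_congr fun n => ?_
    rw [SchwartzMap.smulLeftCLM_apply_apply (phaseFun_hasTemperateGrowth N), phaseFun_add_int,
      phaseFun_cylPoint hN, smul_eq_mul]
    ring
  rw [this]
  ring

/-- The projection intertwines `T_Q^k` with multiplication by `exp (i k θ₁)`, by a translation of
the index of summation. -/
theorem hasSum_projTheta_TQ_zpow (N : ℕ) (θ : ℝ × ℝ) (c : Weights) (k : ℤ) :
    HasSum (fun n : ℤ => Complex.exp (-(n * θ.1 * Complex.I)) •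
        (TQ ^ n) ((TQ ^ k) (cylState N θ.2 c)))
      (Complex.exp (k * θ.1 * Complex.I) • projState N θ c) := by
  rw [← (Equiv.addRight (-k)).hasSum_iff]
  refine ((hasSum_projState N θ c).const_smul (Complex.exp (k * θ.1 * Complex.I))).congr_fun
    fun n => ?_
  have h1 : (TQ ^ (n + -k)) ((TQ ^ k) (cylState N θ.2 c)) = (TQ ^ n) (cylState N θ.2 c) := by
    change (TQ ^ (n + -k) * TQ ^ k) _ = _
    rw [← zpow_add, neg_add_cancel_right]
  simp only [Function.comp, Equiv.coe_addRight, h1]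
  rw [smul_smul, ← Complex.exp_add]
  congr 2
  push_cast
  ring

theorem TQ_projState (N : ℕ) (θ : ℝ × ℝ) (c : Weights) :
    TQ (projState N θ c) = Complex.exp (θ.1 * Complex.I) • projState N θ c := by
  have h1 := (hasSum_projState N θ c).mapL (TQ : 𝓢'(ℝ, ℂ) →L[ℂ] 𝓢'(ℝ, ℂ))
  have h2 := hasSum_projTheta_TQ_zpow N θ c 1
  rw [Int.cast_one, one_mul] at h2
  refine h1.unique (h2.congr_fun fun n => ?_)
  change TQ (_ • (TQ ^ n) _) = _
  rw [map_smul]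
  congr 1
  change (TQ * TQ ^ n) _ = (TQ ^ n * TQ ^ (1 : ℤ)) _
  rw [← zpow_one_add, ← zpow_add, add_comm]

variable {N : ℕ} {k : ℤ}

theorem CylMotion.proj_eq (ψ : CylMotion N k) (θ : ℝ × ℝ) :
    ψ.proj θ = projState N θ (ψ.1 θ.2) := projTheta_cylState N θ _

theorem CylMotion.proj_mem_HT (hN : N ≠ 0) (ψ : CylMotion N k) (θ : ℝ × ℝ) :
    ψ.proj θ ∈ HT N (toThetaTorus θ) := by
  rw [ψ.proj_eq]
  refine ⟨Module.End.mem_eigenspace_iff.2 ?_, Module.End.mem_eigenspace_iff.2 ?_⟩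
  · rw [toThetaTorus, Real.Angle.toCircle_coe, Circle.coe_exp]
    exact TQ_projState N θ _
  · rw [toThetaTorus, Real.Angle.toCircle_coe, Circle.coe_exp]
    exact TP_projState hN θ _

theorem CylMotion.proj_add_two_pi_fst (ψ : CylMotion N k) (θ : ℝ × ℝ) :
    ψ.proj (θ.1 + 2 * Real.pi, θ.2) = ψ.proj θ := by
  have h : ∀ n : ℤ, Complex.exp (-(n * (θ.1 + 2 * Real.pi : ℝ) * Complex.I))
      = Complex.exp (-(n * θ.1 * Complex.I)) := character_add_two_pi θ.1
  simp only [CylMotion.proj, projTheta, h]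

theorem CylMotion.proj_add_two_pi_snd (ψ : CylMotion N k) (θ : ℝ × ℝ) :
    ψ.proj (θ.1, θ.2 + 2 * Real.pi) = Complex.exp (k * θ.1 * Complex.I) • ψ.proj θ := by
  rw [ψ.proj_eq θ, ← (hasSum_projTheta_TQ_zpow N θ _ k).tsum_eq, CylMotion.proj, CylMotion.state,
    projTheta, ψ.2.2]

/-- The full quasi-periodicity of the projection; `exp (i k n θ₁)` are the transition functions of
the line bundle. -/
theorem CylMotion.proj_add_int (ψ : CylMotion N k) (θ : ℝ × ℝ) (m n : ℤ) :
    ψ.proj (θ.1 + m * (2 * Real.pi), θ.2 + n * (2 * Real.pi))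
      = Complex.exp (k * n * θ.1 * Complex.I) • ψ.proj θ := by
  have h1 : ∀ y, Function.Periodic (fun x => ψ.proj (x, y)) (2 * Real.pi) := fun y x =>
    ψ.proj_add_two_pi_fst (x, y)
  -- after division by `exp (i k θ₁ θ₂ / 2π)` the projection is periodic in `θ₂` as well
  have h2 : Function.Periodic (fun y : ℝ =>
      Complex.exp (-(k * θ.1 * (y / (2 * Real.pi)) * Complex.I)) • ψ.proj (θ.1, y))
      (2 * Real.pi) := fun y => by
    have h := ψ.proj_add_two_pi_snd (θ.1, y)
    have hpi : (Real.pi : ℂ) ≠ 0 := by exact_mod_cast Real.pi_ne_zero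
    simp only at h ⊢
    rw [h, smul_smul, ← Complex.exp_add]
    congr 2
    push_cast
    field_simp
    ring
  have e1 := (h1 (θ.2 + n * (2 * Real.pi))).int_mul m θ.1
  have e2 := h2.int_mul n θ.2
  beta_reduce at e1 e2
  rw [e1, ← one_smul ℂ (ψ.proj (θ.1, θ.2 + n * (2 * Real.pi))), ← Complex.exp_zero,
    ← add_neg_cancel (k * θ.1 * ((θ.2 + n * (2 * Real.pi) : ℝ) / (2 * Real.pi)) * Complex.I : ℂ),
    Complex.exp_add, mul_smul, e2, smul_smul, ← Complex.exp_add]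
  congr 2
  have hpi : (Real.pi : ℂ) ≠ 0 := by exact_mod_cast Real.pi_ne_zero
  push_cast
  field_simp
  ring

/-! ### Continuity of the projection -/

/-- A uniformly bounded pointwise continuous family, weighted by `ℓ¹`, sums to a function jointly
continuous in the point and the weights. -/
theorem continuous_tsum_weights_mul {X : Type*} [TopologicalSpace X] {g : ℤ → X → ℂ} {M : ℝ}
    (hg : ∀ m, Continuous (g m)) (hM : ∀ m x, ‖g m x‖ ≤ M) :
    Continuous fun p : X × Weights => ∑' m, p.2 m * g m p.1 := by
  rw [continuous_iff_continuousAt]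
  rintro ⟨x, c⟩
  have h1 : Continuous fun p : X × Weights => ∑' m, c m * g m p.1 :=
    continuous_tsum (fun m => continuous_const.mul ((hg m).comp continuous_fst))
      ((summable_norm_weights c).mul_right M) fun m p => by
        rw [norm_mul]
        gcongr
        exact hM m _
  have h2 : Filter.Tendsto (fun p : X × Weights => ∑' m, (p.2 - c) m * g m p.1)
      (nhds (x, c)) (nhds 0) := by
    refine squeeze_zero_norm (fun p => norm_tsum_weights_mul_le fun m => hM m p.1) ?_
    have : Continuous fun p : X × Weights => ‖p.2 - c‖ * M := by fun_prop
    simpa using this.tendsto (x, c)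
  have h3 := (h1.tendsto (x, c)).add h2
  rw [add_zero] at h3
  refine h3.congr fun p => ?_
  have ha : ∀ d : Weights, Summable fun m => d m * g m p.1 := fun d =>
    summable_weights_mul fun m => hM m p.1
  rw [← (ha c).tsum_add (ha (p.2 - c))]
  refine tsum_congr fun m => ?_
  rw [lp.coeFn_sub, Pi.sub_apply]
  ring

theorem continuous_toDistribution {X : Type*} [TopologicalSpace X] {f : X → 𝓢'(ℝ, ℂ)}
    (hf : ∀ φ, Continuous fun x => f x φ) : Continuous f :=
  (PointwiseConvergenceCLM.isEmbedding_coeFn (RingHom.id ℂ) 𝓢(ℝ, ℂ) ℂ).continuous_iff.2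
    (continuous_pi hf)

theorem continuous_projState (N : ℕ) :
    Continuous fun p : (ℝ × ℝ) × Weights => projState N p.1 p.2 := by
  refine continuous_toDistribution fun φ => ?_
  have hq : ∀ m, Continuous fun θ : ℝ × ℝ => cylPoint N θ.2 m := fun m => by
    unfold cylPoint
    fun_prop
  have hg : ∀ m, Continuous fun θ : ℝ × ℝ => periodize θ.1 φ (cylPoint N θ.2 m) := fun m =>
    (continuous_periodize φ).comp (continuous_fst.prodMk (hq m))
  exact continuous_tsum_weights_mul hg fun m θ => norm_periodize_le θ.1 φ _

theorem CylMotion.continuous_uncurry_proj :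
    Continuous fun p : CylMotion N k × (ℝ × ℝ) => p.1.proj p.2 := by
  simp only [CylMotion.proj_eq]
  refine (continuous_projState N).comp (continuous_snd.prodMk ?_)
  exact (continuous_subtype_val.comp continuous_fst).eval (continuous_snd.comp continuous_snd)

/-- Every point of `ℝ²` has a translate in the closed fundamental square. -/
theorem exists_int_translate_mem_square (θ : ℝ × ℝ) : ∃ m n : ℤ,
    (θ.1 + m * (2 * Real.pi), θ.2 + n * (2 * Real.pi))
      ∈ Set.Icc (0 : ℝ) (2 * Real.pi) ×ˢ Set.Icc (0 : ℝ) (2 * Real.pi) := by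
  have h : ∀ x : ℝ, ∃ m : ℤ, x + m * (2 * Real.pi) ∈ Set.Icc (0 : ℝ) (2 * Real.pi) := fun x => by
    obtain ⟨m, hm, -⟩ := existsUnique_add_zsmul_mem_Ico Real.two_pi_pos x 0
    rw [zsmul_eq_mul, zero_add] at hm
    exact ⟨m, Set.Ico_subset_Icc_self hm⟩
  obtain ⟨m, hm⟩ := h θ.1
  obtain ⟨n, hn⟩ := h θ.2
  exact ⟨m, n, hm, hn⟩

theorem CylMotion.isOpen_forall_proj_ne_zero :
    IsOpen {ψ : CylMotion N k | ∀ θ : ℝ × ℝ, ψ.proj θ ≠ 0} := by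
  have hsq : {ψ : CylMotion N k | ∀ θ : ℝ × ℝ, ψ.proj θ ≠ 0} = {ψ | ∀ θ ∈
      Set.Icc (0 : ℝ) (2 * Real.pi) ×ˢ Set.Icc (0 : ℝ) (2 * Real.pi), ψ.proj θ ≠ 0} := by
    ext ψ
    refine ⟨fun h θ _ => h θ, fun h θ h0 => ?_⟩
    obtain ⟨m, n, hmn⟩ := exists_int_translate_mem_square θ
    refine h _ hmn ?_
    rw [ψ.proj_add_int, h0]
    exact smul_zero (M := ℂ) (A := 𝓢'(ℝ, ℂ)) _
  rw [hsq, isOpen_iff_mem_nhds]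
  intro ψ hψ
  refine (isCompact_Icc.prod isCompact_Icc).eventually_forall_of_forall_eventually
    fun θ hθ => ?_
  exact CylMotion.continuous_uncurry_proj.continuousAt.eventually_ne (hψ θ hθ)

/-! ### Generic weights -/

/-- The projections `P_θ` of the states with weights `c` vanish for no `θ`, read on coefficients. -/
def NonvanishingProj (N : ℕ) (c : Weights) : Prop := ∀ θ : ℝ, ∃ j : ℤ, coef N θ j c ≠ 0

/-- The coefficients of the projections `P_θ` are `C¹` functions of `θ`. -/
def SmoothCoef (N : ℕ) (c : Weights) : Prop := ∀ j : ℤ, ContDiff ℝ 1 fun θ => coef N θ j c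

theorem NonvanishingProj.smul {N : ℕ} {c : Weights} (hc : NonvanishingProj N c) {r : ℝ}
    (hr : r ≠ 0) : NonvanishingProj N (r • c) := fun θ => by
  obtain ⟨j, hj⟩ := hc θ
  refine ⟨j, ?_⟩
  rw [coef_smul]
  exact mul_ne_zero (by exact_mod_cast hr) hj

theorem NonvanishingProj.shift {N : ℕ} {c : Weights} (hc : NonvanishingProj N c) (a : ℤ) :
    NonvanishingProj N (shift a c) := fun θ => by
  obtain ⟨j, hj⟩ := hc θ
  refine ⟨j - a, ?_⟩
  rwa [coef_shift, sub_add_cancel]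

theorem SmoothCoef.shift {N : ℕ} {c : Weights} (hc : SmoothCoef N c) (a : ℤ) :
    SmoothCoef N (shift a c) := fun j => by
  simp only [coef_shift]
  exact hc (j + a)

theorem smoothCoef_zero (N : ℕ) : SmoothCoef N 0 := fun j => by
  simp only [coef_zero]
  exact contDiff_const

theorem SmoothCoef.add {N : ℕ} (hN : N ≠ 0) {c d : Weights} (hc : SmoothCoef N c)
    (hd : SmoothCoef N d) : SmoothCoef N (c + d) := fun j => by
  simp only [coef_add hN]
  exact (hc j).add (hd j)

theorem SmoothCoef.sum {N : ℕ} (hN : N ≠ 0) {ι : Type*} {s : Finset ι} {f : ι → Weights}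
    (hf : ∀ i ∈ s, SmoothCoef N (f i)) : SmoothCoef N (∑ i ∈ s, f i) :=
  Finset.sum_induction _ (SmoothCoef N) (fun _ _ => SmoothCoef.add hN) (smoothCoef_zero N) hf

theorem smoothCoef_single {N : ℕ} (hN : N ≠ 0) (i : ℤ) (a : ℂ) :
    SmoothCoef N (lp.single 1 i a : Weights) := fun j => by
  by_cases h : ∃ n : ℤ, j - n * N = i
  · obtain ⟨n, rfl⟩ := h
    have hc : ∀ θ, coef N θ j (lp.single 1 (j - n * N) a : Weights) = character θ n * a :=
        fun θ => by
      rw [coef, tsum_eq_single n fun m hm => ?_, lp.single_apply_self]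
      rw [lp.single_apply_ne _ _ _ (by simpa [hN] using hm), mul_zero]
    simp only [hc]
    exact ((contDiff_character n).of_le (by norm_num)).mul contDiff_const
  · have hc : ∀ θ, coef N θ j (lp.single 1 i a : Weights) = 0 := fun θ => by
      rw [coef]
      refine (tsum_congr fun n => ?_).trans tsum_zero
      rw [lp.single_apply_ne _ _ _ fun h' => h ⟨n, h'⟩, mul_zero]
    simp only [hc]
    exact contDiff_const

theorem exists_smoothCoef_near {N : ℕ} (hN : N ≠ 0) (q : Weights) {ε : ℝ} (hε : 0 < ε) :
    ∃ p, SmoothCoef N p ∧ ‖p - q‖ < ε := by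
  have h := lp.hasSum_single (p := 1) (by simp) q
  obtain ⟨s, hs⟩ := ((Metric.tendsto_nhds.1 h) ε hε).exists
  exact ⟨_, SmoothCoef.sum hN fun i _ => smoothCoef_single hN i _, by rwa [← dist_eq_norm]⟩

/-- Weights at the points `q_0, …, q_{N - 1}`, on which the coefficients do not depend on `θ`. -/
def fundamentalWeights (N : ℕ) (v : Fin N → ℂ) : Weights :=
  ∑ i : Fin N, lp.single 1 (i : ℤ) (v i)

theorem coef_fundamentalWeights {N : ℕ} (θ : ℝ) (v : Fin N → ℂ) (j : Fin N) :
    coef N θ j (fundamentalWeights N v) = v j := by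
  have hv : ∀ l : ℤ, fundamentalWeights N v l = ∑ i : Fin N, (Pi.single (i : ℤ) (v i) : ℤ → ℂ) l :=
    fun l => by
      rw [fundamentalWeights, lp.coeFn_sum, Finset.sum_apply]
      rfl
  rw [coef, tsum_eq_single 0 fun n hn => ?_]
  · rw [character_zero_right, zero_mul, sub_zero, one_mul, hv,
      Finset.sum_eq_single j (fun i _ hij => ?_) (by simp), Pi.single_eq_same]
    exact Pi.single_eq_of_ne (fun h => hij (Fin.ext (by exact_mod_cast h.symm))) _
  · rw [hv, Finset.sum_eq_zero fun i _ => ?_, mul_zero]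
    refine Pi.single_eq_of_ne (fun h => ?_) _
    have h1 := i.2
    have h2 := j.2
    -- `j - n N = i` with `0 ≤ i, j < N` forces `n = 0`
    rcases lt_or_gt_of_ne hn with hn | hn <;> nlinarith

theorem continuous_fundamentalWeights (N : ℕ) : Continuous (fundamentalWeights N) :=
  continuous_finsetSum _ fun i _ => (lp.isometry_single (i : ℤ)).continuous.comp (continuous_apply i)

theorem fundamentalWeights_zero (N : ℕ) : fundamentalWeights N 0 = 0 := by
  simp [fundamentalWeights]

/-- The curves `θ ↦ p(θ) ∈ ℂ^N` of coefficients being one-dimensional, a constant perturbation of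
`p` makes them avoid the cones `- r u(θ)`, `- r w(θ)`: these are the values of `C¹` functions of two
real variables, and `2 < 2 N`. -/
theorem exists_generic_near {N : ℕ} (hN : 2 ≤ N) {u w : Weights} (hu : SmoothCoef N u)
    (hw : SmoothCoef N w) (q : Weights) {ε : ℝ} (hε : 0 < ε) :
    ∃ p, SmoothCoef N p ∧ ‖p - q‖ < ε ∧
      ∀ r : ℝ, NonvanishingProj N (p + r • u) ∧ NonvanishingProj N (p + r • w) := by
  have hN0 : N ≠ 0 := by omega
  obtain ⟨p₀, hp₀, hq⟩ := exists_smoothCoef_near hN0 q hε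
  let F : Weights → ℝ × ℝ → Fin N → ℂ := fun x y j => -(coef N y.1 j p₀ + y.2 * coef N y.1 j x)
  have hF : ∀ x, SmoothCoef N x → ContDiff ℝ 1 (F x) := fun x hx => by
    refine contDiff_pi.2 fun j => ?_
    exact (((hp₀ j).comp contDiff_fst).add
      ((Complex.ofRealCLM.contDiff.comp contDiff_snd).mul ((hx j).comp contDiff_fst))).neg
  have hdim : ∀ x, SmoothCoef N x →
      dimH (Set.range (F x)) < Module.finrank ℝ (Fin N → ℂ) := fun x hx => by
    refine (hF x hx).dimH_range_le.trans_lt ?_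
    have h1 : Module.finrank ℝ (ℝ × ℝ) = 2 := by simp
    have h2 : Module.finrank ℝ (Fin N → ℂ) = N * 2 := by
      simp [Module.finrank_pi_fintype, Complex.finrank_real_complex]
    rw [h1, h2]
    exact_mod_cast (by omega : 2 < N * 2)
  have hdense : Dense (Set.range (F u) ∪ Set.range (F w))ᶜ := by
    refine dense_compl_of_dimH_lt_finrank ?_
    rw [dimH_union]
    exact max_lt (hdim u hu) (hdim w hw)
  have hopen : IsOpen {v : Fin N → ℂ | ‖p₀ + fundamentalWeights N v - q‖ < ε} := by
    have := continuous_fundamentalWeights N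
    exact isOpen_lt (by fun_prop) continuous_const
  obtain ⟨v, hv, hvF⟩ := hdense.inter_open_nonempty _ hopen
    ⟨0, by simpa [fundamentalWeights_zero] using hq⟩
  have key : ∀ x, v ∉ Set.range (F x) → ∀ r : ℝ,
      NonvanishingProj N (p₀ + fundamentalWeights N v + r • x) := fun x hx r θ => by
    by_contra! h
    refine hx ⟨(θ, r), funext fun j => ?_⟩
    have hj := h j
    rw [coef_add hN0, coef_add hN0, coef_smul, coef_fundamentalWeights] at hj
    linear_combination -hj
  rw [Set.mem_compl_iff, Set.mem_union, not_or] at hvF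
  exact ⟨_, hp₀.add hN0 (SmoothCoef.sum hN0 fun i _ => smoothCoef_single hN0 _ _), hv,
    fun r => ⟨key u hvF.1 r, key w hvF.2 r⟩⟩

/-! ### Piecewise linear approximation of a motion -/

/-- The segment from `c` to `d` consists of weights with nowhere vanishing projections. -/
def NonvanishingSegment (N : ℕ) (c d : Weights) : Prop :=
  ∀ s ∈ Set.Icc (0 : ℝ) 1, NonvanishingProj N ((1 - s) • c + s • d)

theorem NonvanishingSegment.symm {N : ℕ} {c d : Weights} (h : NonvanishingSegment N c d) :
    NonvanishingSegment N d c := fun s hs => by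
  have := h (1 - s) ⟨by linarith [hs.2], by linarith [hs.1]⟩
  rwa [sub_sub_cancel, add_comm] at this

theorem NonvanishingSegment.shift {N : ℕ} {c d : Weights} (h : NonvanishingSegment N c d) (a : ℤ) :
    NonvanishingSegment N (shift a c) (shift a d) := fun s hs => by
  have := (h s hs).shift a
  rwa [map_add, shift_real_smul, shift_real_smul] at this

theorem nonvanishingSegment_of_forall_add_smul {N : ℕ} {u p : Weights}
    (hu : NonvanishingProj N u) (hp : ∀ r : ℝ, NonvanishingProj N (p + r • u)) :
    NonvanishingSegment N u p := fun s _ => by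
  rcases eq_or_ne s 0 with rfl | hs
  · simpa using hu
  · have := (hp ((1 - s) / s)).smul hs
    rwa [smul_add, smul_smul, mul_div_cancel₀ _ hs, add_comm] at this

/-- A relation invariant under `(i, x) ↦ (i + m, shift a x)` admits an equivariant choice. -/
theorem exists_equivariant_choice {m a : ℤ} (hm : 0 < m) {R : ℤ → Weights → Prop}
    (hR : ∀ i x n, R i x → R (i + n * m) (shift (n * a) x)) (hex : ∀ i, ∃ x, R i x) :
    ∃ F : ℤ → Weights, (∀ i, R i (F i)) ∧ ∀ i n, F (i + n * m) = shift (n * a) (F i) := by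
  choose F₀ hF₀ using hex
  refine ⟨fun i => shift (i / m * a) (F₀ (i % m)), fun i => ?_, fun i n => ?_⟩
  · have := hR _ _ (i / m) (hF₀ (i % m))
    rwa [mul_comm (i / m) m, Int.emod_add_mul_ediv] at this
  · beta_reduce
    rw [shift_shift, Int.add_mul_ediv_right _ _ hm.ne', Int.add_mul_emod_self_right, add_comm (i / m),
      add_mul]

/-- Equivariant nodes close to `f`, with nonvanishing segments between successive nodes. The even
nodes are chosen first; each odd node has then to avoid two cones only. -/
theorem exists_nodes {N : ℕ} (hN : 2 ≤ N) {m a : ℤ} (hm : 0 < m) {f : ℤ → Weights}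
    (hf : ∀ i n, f (i + n * (2 * m)) = shift (n * a) (f i)) {ε : ℝ} (hε : 0 < ε) :
    ∃ p : ℤ → Weights, (∀ i, ‖p i - f i‖ < ε) ∧ (∀ i, NonvanishingSegment N (p i) (p (i + 1))) ∧
      ∀ i n, p (i + n * (2 * m)) = shift (n * a) (p i) := by
  have hnorm : ∀ (b : ℤ) (x y : Weights), ‖shift b x - shift b y‖ = ‖x - y‖ := fun b x y => by
    rw [← map_sub, LinearIsometry.norm_map]
  obtain ⟨E, hE, hE'⟩ := exists_equivariant_choice (m := m) (a := a) hm
    (R := fun i x => SmoothCoef N x ∧ NonvanishingProj N x ∧ ‖x - f (2 * i)‖ < ε)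
    (fun i x n h => by
      refine ⟨h.1.shift _, h.2.1.shift _, ?_⟩
      rw [show 2 * (i + n * m) = 2 * i + n * (2 * m) by ring, hf, hnorm]
      exact h.2.2)
    fun i => by
      obtain ⟨p, h1, h2, h3⟩ := exists_generic_near hN (smoothCoef_zero N) (smoothCoef_zero N)
        (f (2 * i)) hε
      exact ⟨p, h1, by simpa using (h3 0).1, h2⟩
  obtain ⟨O, hO, hO'⟩ := exists_equivariant_choice (m := m) (a := a) hm
    (R := fun i x => ‖x - f (2 * i + 1)‖ < ε ∧ NonvanishingSegment N (E i) x ∧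
      NonvanishingSegment N x (E (i + 1)))
    (fun i x n h => by
      rw [show 2 * (i + n * m) + 1 = 2 * i + 1 + n * (2 * m) by ring,
        show i + n * m + 1 = i + 1 + n * m by ring, hf, hnorm, hE', hE']
      exact ⟨h.1, h.2.1.shift _, h.2.2.shift _⟩)
    fun i => by
      obtain ⟨p, -, h2, h3⟩ := exists_generic_near hN (hE i).1 (hE (i + 1)).1 (f (2 * i + 1)) hε
      exact ⟨p, h2, nonvanishingSegment_of_forall_add_smul (hE i).2.1 fun r => (h3 r).1,
        (nonvanishingSegment_of_forall_add_smul (hE (i + 1)).2.1 fun r => (h3 r).2).symm⟩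
  let p : ℤ → Weights := fun i => if Even i then E (i / 2) else O (i / 2)
  have hp0 : ∀ i, p (2 * i) = E i := fun i => by simp [p]
  have hp1 : ∀ i, p (2 * i + 1) = O i := fun i => by
    have h1 : ¬ Even (2 * i + 1) := by simp
    have h2 : (2 * i + 1) / 2 = i := by omega
    simp only [p, if_neg h1, h2]
  have hcases : ∀ {P : ℤ → Prop}, (∀ i, P (2 * i)) → (∀ i, P (2 * i + 1)) → ∀ i, P i :=
    fun h0 h1 i => by
      obtain ⟨j, rfl | rfl⟩ := Int.even_or_odd' i
      exacts [h0 j, h1 j]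
  refine ⟨p, hcases (fun i => ?_) (fun i => ?_), hcases (fun i => ?_) (fun i => ?_),
    hcases (fun i n => ?_) (fun i n => ?_)⟩
  · rw [hp0]; exact (hE i).2.2
  · rw [hp1]; exact (hO i).1
  · rw [hp0, hp1]; exact (hO i).2.1
  · rw [hp1, show 2 * i + 1 + 1 = 2 * (i + 1) by ring, hp0]; exact (hO i).2.2
  · rw [show 2 * i + n * (2 * m) = 2 * (i + n * m) by ring, hp0, hp0, hE']
  · rw [show 2 * i + 1 + n * (2 * m) = 2 * (i + n * m) + 1 by ring, hp1, hp1, hO']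

/-- The piecewise linear function with value `p i` at the integer `i`. -/
def interpolate (p : ℤ → Weights) (x : ℝ) : Weights :=
  (1 - Int.fract x) • p ⌊x⌋ + Int.fract x • p (⌊x⌋ + 1)

theorem continuous_interpolate (p : ℤ → Weights) : Continuous (interpolate p) := by
  have hlf : LocallyFinite fun i : ℤ => Set.Icc (i : ℝ) (i + 1) :=
    locallyFinite_Icc_of_tendsto
      tendsto_intCast_atTop_atTop
      (Filter.tendsto_atBot_add_const_right _ 1 (tendsto_intCast_atBot_iff.2 Filter.tendsto_id))
  refine hlf.continuous (Set.iUnion_eq_univ_iff.2 fun x =>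
    ⟨⌊x⌋, Int.floor_le x, (Int.lt_floor_add_one x).le⟩) (fun _ => isClosed_Icc) fun i => ?_
  have h : Set.EqOn (fun x : ℝ => (1 - (x - i)) • p i + (x - i) • p (i + 1)) (interpolate p)
      (Set.Icc (i : ℝ) (i + 1)) := fun x hx => by
    rcases hx.2.eq_or_lt with rfl | h
    · simp [interpolate]
    · have hfl : ⌊x⌋ = i := Int.floor_eq_iff.2 ⟨hx.1, h⟩
      simp only [interpolate, Int.fract, hfl]
  refine ContinuousOn.congr ?_ h.symm
  fun_prop

/-- The translations being isometries, uniform continuity on two periods suffices. -/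
theorem uniformContinuous_of_equivariant {c : ℝ → Weights} {a : ℤ} (hc : Continuous c)
    (ha : ∀ t (n : ℤ), c (t + n * (2 * Real.pi)) = shift (n * a) (c t)) : UniformContinuous c := by
  have hpi := Real.two_pi_pos
  rw [Metric.uniformContinuous_iff]
  intro ε hε
  obtain ⟨δ, hδ, h⟩ := Metric.uniformContinuousOn_iff.1
    ((isCompact_Icc (a := -(2 * Real.pi)) (b := 2 * (2 * Real.pi))).uniformContinuousOn_of_continuous
      hc.continuousOn) ε hε
  refine ⟨min δ (2 * Real.pi), lt_min hδ hpi, fun {s t} hst => ?_⟩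
  obtain ⟨n, hn, -⟩ := existsUnique_add_zsmul_mem_Ico hpi s 0
  rw [zsmul_eq_mul, zero_add] at hn
  rw [Real.dist_eq] at hst
  have h1 := abs_lt.1 (hst.trans_le (min_le_right _ _))
  have := h (s + n * (2 * Real.pi)) ⟨by linarith [hn.1], by linarith [hn.2]⟩
    (t + n * (2 * Real.pi)) ⟨by linarith [hn.1], by linarith [hn.2]⟩
    (by rw [dist_add_right, Real.dist_eq]; exact hst.trans_le (min_le_left _ _))
  rwa [ha, ha, LinearIsometry.dist_map] at this

/-- Interpolation between `2 M` nodes per period approximates an equivariant path by one whose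
projections vanish nowhere. -/
theorem exists_nonvanishing_near {N : ℕ} (hN : 2 ≤ N) {c : ℝ → Weights} {a : ℤ} (hc : Continuous c)
    (ha : ∀ t (n : ℤ), c (t + n * (2 * Real.pi)) = shift (n * a) (c t)) {ε : ℝ} (hε : 0 < ε) :
    ∃ d : ℝ → Weights, Continuous d ∧ (∀ t, d (t + 2 * Real.pi) = shift a (d t)) ∧
      (∀ t, dist (c t) (d t) < ε) ∧ ∀ t, NonvanishingProj N (d t) := by
  have hpi := Real.pi_pos
  obtain ⟨δ, hδ, hδc⟩ := Metric.uniformContinuous_iff.1 (uniformContinuous_of_equivariant hc ha)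
    (ε / 2) (half_pos hε)
  -- `2 M` nodes per period `2π` have mesh `π / M < δ`
  obtain ⟨M, hM⟩ := exists_nat_gt (Real.pi / δ)
  have hM0 : (0 : ℝ) < M := (div_pos hpi hδ).trans hM
  have hMδ : Real.pi / M < δ := by
    rw [div_lt_iff₀ hδ] at hM
    rw [div_lt_iff₀ hM0]
    linarith
  obtain ⟨p, hp1, hp2, hp3⟩ := exists_nodes hN (m := M) (a := a) (by exact_mod_cast hM0)
    (f := fun i => c (i * (Real.pi / M))) (fun i n => by
      rw [← ha]
      congr 1
      push_cast
      field_simp) (half_pos hε)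
  have hnear : ∀ (t : ℝ) (i : ℤ), |t * (M / Real.pi) - i| ≤ 1 → p i ∈ Metric.ball (c t) ε :=
    fun t i hi => by
      have h1 : dist (c (i * (Real.pi / M))) (c t) < ε / 2 := by
        refine hδc ?_
        have : i * (Real.pi / M) - t = -((Real.pi / M) * (t * (M / Real.pi) - i)) := by
          field_simp
          ring
        rw [Real.dist_eq, this, abs_neg, abs_mul, abs_of_pos (by positivity)]
        refine lt_of_le_of_lt ?_ hMδ
        exact mul_le_of_le_one_right (by positivity) hi
      have h2 := hp1 i
      rw [← dist_eq_norm] at h2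
      exact (dist_triangle _ _ _).trans_lt (by linarith)
  refine ⟨fun t => interpolate p (t * (M / Real.pi)), (continuous_interpolate p).comp (by fun_prop),
    fun t => ?_, fun t => ?_, fun t => ?_⟩
  · have e : (t + 2 * Real.pi) * (M / Real.pi) = t * (M / Real.pi) + ((2 * M : ℤ) : ℝ) := by
      push_cast
      field_simp
    have hp4 : ∀ i, p (i + 2 * M) = shift a (p i) := fun i => by simpa using hp3 i 1
    simp only [interpolate, e, Int.fract_add_intCast, Int.floor_add_intCast, map_add,
      shift_real_smul, hp4, add_right_comm _ (2 * (M : ℤ)) 1]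
  · rw [dist_comm, ← Metric.mem_ball]
    set x := t * (M / Real.pi) with hx
    have hf0 := Int.fract_nonneg x
    have hf1 := Int.fract_lt_one x
    refine convex_ball (c t) ε (hnear t ⌊x⌋ ?_) (hnear t (⌊x⌋ + 1) ?_) (sub_nonneg.2 hf1.le) hf0
      (by ring)
    · rw [← hx, abs_le]
      constructor <;> linarith [Int.self_sub_floor x]
    · rw [← hx, abs_le]
      push_cast
      constructor <;> linarith [Int.self_sub_floor x]
  · exact hp2 _ _ ⟨Int.fract_nonneg _, (Int.fract_lt_one _).le⟩

theorem CylMotion.weights_add_int (hN : N ≠ 0) (ψ : CylMotion N k) (t : ℝ) (n : ℤ) :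
    ψ.1 (t + n * (2 * Real.pi)) = shift (n * (1 - k * N)) (ψ.1 t) := by
  have h1 : ∀ t, ψ.1 (t + 2 * Real.pi) = shift (1 - k * N) (ψ.1 t) := fun t =>
    (cylState_add_two_pi_eq_iff hN k t _ _).1 (ψ.2.2 t)
  induction n with
  | zero => simp [shift_zero]
  | succ n ih =>
    have e : t + ((n + 1 : ℤ) : ℝ) * (2 * Real.pi)
      = t + ((n : ℤ) : ℝ) * (2 * Real.pi) + 2 * Real.pi := by push_cast; ring
    rw [e, h1, ih, shift_shift]
    congr 2
    ring
  | pred n ih =>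
    have e : t + ((-n : ℤ) : ℝ) * (2 * Real.pi)
      = t + ((-n - 1 : ℤ) : ℝ) * (2 * Real.pi) + 2 * Real.pi := by push_cast; ring
    rw [e, h1] at ih
    refine (shift (1 - k * N)).injective (ih.trans ?_)
    rw [shift_shift]
    congr 2
    ring

theorem CylMotion.dense_forall_proj_ne_zero (hN : 2 ≤ N) :
    Dense {ψ : CylMotion N k | ∀ θ : ℝ × ℝ, ψ.proj θ ≠ 0} := by
  have hN0 : N ≠ 0 := by omega
  intro ψ
  choose d hd1 hd2 hd3 hd4 using fun n : ℕ => exists_nonvanishing_near hN ψ.1.continuous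
    (ψ.weights_add_int hN0) (Nat.one_div_pos_of_nat (α := ℝ) (n := n))
  have hproj : ∀ n (θ : ℝ × ℝ), projTheta θ.1 (cylState N θ.2 (d n θ.2)) ≠ 0 := fun n θ => by
    obtain ⟨j, hj⟩ := hd4 n θ.2 θ.1
    rw [projTheta_cylState]
    exact projState_ne_zero hN0 hj
  let ψ' : ℕ → CylMotion N k := fun n => ⟨⟨d n, hd1 n⟩, fun t h0 => hproj n (0, t) (by
      simp only [ContinuousMap.coe_mk] at h0
      simp [h0, projTheta]),
    fun t => (cylState_add_two_pi_eq_iff hN0 k t _ _).2 (hd2 n t)⟩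
  refine mem_closure_of_tendsto (f := ψ') (b := Filter.atTop) ?_
    (Filter.Eventually.of_forall fun n θ => hproj n θ)
  rw [tendsto_subtype_rng]
  refine ContinuousMap.tendsto_of_tendstoLocallyUniformly
    (TendstoUniformly.tendstoLocallyUniformly (Metric.tendstoUniformly_iff.2 fun ε hε => ?_))
  filter_upwards [(tendsto_one_div_add_atTop_nhds_zero_nat (𝕜 := ℝ)).eventually_lt_const hε]
    with n hn t
  exact (hd3 n t).trans hn

/-! ### Local lifts from the torus to the plane -/

/-- The representative of the angle `t` in `(a - π, a + π]`. -/
def angleLift (a : ℝ) (t : Real.Angle) : ℝ := a + (t - (a : Real.Angle)).toReal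

theorem coe_angleLift (a : ℝ) (t : Real.Angle) : (angleLift a t : Real.Angle) = t := by
  rw [angleLift, Real.Angle.coe_add, Real.Angle.coe_toReal, add_sub_cancel]

/-- Away from its jump the lift is a local inverse of `ℝ → ℝ / 2πℤ`. -/
theorem eventually_angleLift_add {a : ℝ} {t : Real.Angle} (ht : t - (a : Real.Angle) ≠ Real.pi) :
    ∀ᶠ r : ℝ in nhds 0, angleLift a (t + (r : Real.Angle)) = angleLift a t + r := by
  have h1 : (t - (a : Real.Angle)).toReal < Real.pi :=
    (Real.Angle.toReal_le_pi _).lt_of_ne fun h => ht (Real.Angle.toReal_eq_pi_iff.1 h)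
  have h2 := Real.Angle.neg_pi_lt_toReal (t - (a : Real.Angle))
  have hc : Filter.Tendsto (fun r : ℝ => (t - (a : Real.Angle)).toReal + r) (nhds 0)
      (nhds ((t - (a : Real.Angle)).toReal)) := by
    have : Continuous fun r : ℝ => (t - (a : Real.Angle)).toReal + r := by fun_prop
    simpa using this.tendsto 0
  filter_upwards [hc.eventually_lt_const h1, hc.eventually_const_lt h2] with r hr1 hr2
  have h3 := Real.Angle.toReal_coe_eq_self_iff.2 ⟨hr2, hr1.le⟩
  rw [Real.Angle.coe_add, Real.Angle.coe_toReal] at h3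
  rw [angleLift, angleLift, add_sub_right_comm, h3, add_assoc]

theorem eventually_angleLift_coe {a x₀ : ℝ} (h : (x₀ : Real.Angle) - (a : Real.Angle) ≠ Real.pi) :
    ∀ᶠ x : ℝ in nhds x₀, angleLift a x = angleLift a x₀ + (x - x₀) := by
  have hc : Filter.Tendsto (fun x : ℝ => x - x₀) (nhds x₀) (nhds 0) := by
    have : Continuous fun x : ℝ => x - x₀ := by fun_prop
    simpa using this.tendsto x₀
  filter_upwards [hc.eventually (eventually_angleLift_add h)] with x hx
  rwa [← Real.Angle.coe_add, add_sub_cancel] at hx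

theorem continuousAt_angleLift {a : ℝ} {t : Real.Angle} (ht : t - (a : Real.Angle) ≠ Real.pi) :
    ContinuousAt (angleLift a) t := by
  induction t using Real.Angle.induction_on with | _ x
  have hn : nhds (x : Real.Angle) = Filter.map (↑) (nhds x) := QuotientAddGroup.nhds_eq _ x
  rw [ContinuousAt, hn, Filter.tendsto_map'_iff]
  refine Filter.Tendsto.congr' (f₁ := fun y : ℝ => angleLift a x + (y - x))
    ((eventually_angleLift_coe ht).mono fun y hy => hy.symm) ?_
  have : Continuous fun y : ℝ => angleLift a x + (y - x) := by fun_prop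
  simpa using this.tendsto x

/-- The number of turns between the lifts of `t` based at `a` and at `b`. -/
def turns (a b : ℝ) (t : Real.Angle) : ℤ := round ((angleLift b t - angleLift a t) / (2 * Real.pi))

theorem angleLift_eq_add_turns (a b : ℝ) (t : Real.Angle) :
    angleLift b t = angleLift a t + turns a b t * (2 * Real.pi) := by
  obtain ⟨n, hn⟩ := Real.Angle.angle_eq_iff_two_pi_dvd_sub.1
    ((coe_angleLift b t).trans (coe_angleLift a t).symm)
  have h : (angleLift b t - angleLift a t) / (2 * Real.pi) = n := by
    rw [hn]
    field_simp
  rw [turns, h, round_intCast]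
  linarith

theorem eventually_turns_add {a b : ℝ} {t : Real.Angle} (ha : t - (a : Real.Angle) ≠ Real.pi)
    (hb : t - (b : Real.Angle) ≠ Real.pi) :
    ∀ᶠ r : ℝ in nhds 0, turns a b (t + (r : Real.Angle)) = turns a b t := by
  filter_upwards [eventually_angleLift_add ha, eventually_angleLift_add hb] with r hra hrb
  rw [turns, turns, hra, hrb, add_sub_add_right_eq_sub]

theorem eventually_turns_coe {a b x₀ : ℝ} (ha : (x₀ : Real.Angle) - (a : Real.Angle) ≠ Real.pi)
    (hb : (x₀ : Real.Angle) - (b : Real.Angle) ≠ Real.pi) :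
    ∀ᶠ x : ℝ in nhds x₀, turns a b x = turns a b x₀ := by
  filter_upwards [eventually_angleLift_coe ha, eventually_angleLift_coe hb] with x hxa hxb
  rw [turns, turns, hxa, hxb, add_sub_add_right_eq_sub]

/-- The torus without the two circles opposite to the point `a`. -/
def chartDomain (a : ℝ × ℝ) : Set ThetaTorus :=
  {t | t.1 - (a.1 : Real.Angle) ≠ Real.pi ∧ t.2 - (a.2 : Real.Angle) ≠ Real.pi}

/-- The lift of `T_θ` to the square of side `2π` centred at `a`. -/
def torusLift (a : ℝ × ℝ) (t : ThetaTorus) : ℝ × ℝ := (angleLift a.1 t.1, angleLift a.2 t.2)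

theorem toThetaTorus_torusLift (a : ℝ × ℝ) (t : ThetaTorus) : toThetaTorus (torusLift a t) = t :=
  Prod.ext (coe_angleLift a.1 t.1) (coe_angleLift a.2 t.2)

theorem isOpen_chartDomain (a : ℝ × ℝ) : IsOpen (chartDomain a) :=
  (isOpen_ne.preimage (continuous_fst.sub continuous_const)).inter
    (isOpen_ne.preimage (continuous_snd.sub continuous_const))

theorem continuousOn_torusLift (a : ℝ × ℝ) : ContinuousOn (torusLift a) (chartDomain a) := by
  intro t ht
  exact (((continuousAt_angleLift ht.1).comp continuousAt_fst).prodMk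
    ((continuousAt_angleLift ht.2).comp continuousAt_snd)).continuousWithinAt

theorem exists_mem_chartDomain (t : ThetaTorus) : ∃ a, t ∈ chartDomain a := by
  refine ⟨torusLift 0 t, ?_, ?_⟩
  · rw [torusLift, coe_angleLift, sub_self]
    exact Real.Angle.pi_ne_zero.symm
  · rw [torusLift, coe_angleLift, sub_self]
    exact Real.Angle.pi_ne_zero.symm

theorem exists_int_translate_of_toThetaTorus_eq {θ η : ℝ × ℝ}
    (h : toThetaTorus η = toThetaTorus θ) :
    ∃ m n : ℤ, η = (θ.1 + m * (2 * Real.pi), θ.2 + n * (2 * Real.pi)) := by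
  obtain ⟨m, hm⟩ := Real.Angle.angle_eq_iff_two_pi_dvd_sub.1 (congrArg Prod.fst h)
  obtain ⟨n, hn⟩ := Real.Angle.angle_eq_iff_two_pi_dvd_sub.1 (congrArg Prod.snd h)
  exact ⟨m, n, Prod.ext (by simp only; linarith) (by simp only; linarith)⟩

/-! ### The line bundle spanned by the projection -/

/-- The line spanned by `ψ̃(θ)`, for a representative `θ` of the point of the torus. -/
def CylMotion.line (ψ : CylMotion N k) (t : ThetaTorus) : Submodule ℂ 𝓢'(ℝ, ℂ) :=
  Submodule.span ℂ {ψ.proj (torusLift 0 t)}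

theorem CylMotion.line_toThetaTorus (ψ : CylMotion N k) (θ : ℝ × ℝ) :
    ψ.line (toThetaTorus θ) = Submodule.span ℂ {ψ.proj θ} := by
  obtain ⟨m, n, h⟩ := exists_int_translate_of_toThetaTorus_eq
    (toThetaTorus_torusLift 0 (toThetaTorus θ))
  rw [CylMotion.line, h, ψ.proj_add_int]
  exact Submodule.span_singleton_smul_eq (Complex.exp_ne_zero _).isUnit _

theorem CylMotion.line_eq_span (ψ : CylMotion N k) (a : ℝ × ℝ) (t : ThetaTorus) :
    ψ.line t = Submodule.span ℂ {ψ.proj (torusLift a t)} := by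
  rw [← ψ.line_toThetaTorus, toThetaTorus_torusLift]

theorem CylMotion.continuous_proj (ψ : CylMotion N k) : Continuous ψ.proj :=
  CylMotion.continuous_uncurry_proj.uncurry_left ψ

theorem CylMotion.continuousOn_frame (ψ : CylMotion N k) (a : ℝ × ℝ) :
    ContinuousOn (fun t => ψ.proj (torusLift a t)) (chartDomain a) :=
  ψ.continuous_proj.comp_continuousOn (continuousOn_torusLift a)

theorem CylMotion.isLineSubbundle_line (hN : N ≠ 0) (ψ : CylMotion N k)
    (hψ : ∀ θ, ψ.proj θ ≠ 0) : IsLineSubbundle N ψ.line where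
  le_HT t := by
    have h := ψ.proj_mem_HT hN (torusLift 0 t)
    rw [toThetaTorus_torusLift] at h
    exact (Submodule.span_singleton_le_iff_mem _ _).2 h
  locally_spanned t := by
    obtain ⟨a, ha⟩ := exists_mem_chartDomain t
    exact ⟨chartDomain a, isOpen_chartDomain a, ha, _, ψ.continuousOn_frame a,
      fun u _ => ⟨hψ _, ψ.line_eq_span a u⟩⟩

/-! ### A connection of constant curvature -/

/-- The transition function `exp (i k n θ₁)` between the frames based at `a` and at `b`, where `n`
is the number of turns between the lifts of `θ₂`. -/
def transition (k : ℤ) (a b : ℝ × ℝ) (t : ThetaTorus) : ℂ :=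
  (t.1.toCircle : ℂ) ^ (k * turns a.2 b.2 t.2)

theorem coe_toCircle_coe_zpow (x : ℝ) (n : ℤ) :
    ((x : Real.Angle).toCircle : ℂ) ^ n = Complex.exp (n * x * Complex.I) := by
  rw [Real.Angle.toCircle_coe, Circle.coe_exp, ← Complex.exp_int_mul, mul_assoc]

theorem transition_ne_zero (k : ℤ) (a b : ℝ × ℝ) (t : ThetaTorus) : transition k a b t ≠ 0 :=
  zpow_ne_zero _ (Circle.coe_ne_zero _)

theorem smoothOn_transition (k : ℤ) (a b : ℝ × ℝ) :
    SmoothOn (transition k a b) (chartDomain a ∩ chartDomain b) := by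
  intro θ₀ h
  have hev : (fun θ : ℝ × ℝ => transition k a b (toThetaTorus θ)) =ᶠ[nhds θ₀]
      fun θ => Complex.exp ((k * turns a.2 b.2 θ₀.2 : ℤ) * θ.1 * Complex.I) := by
    filter_upwards [continuousAt_snd.eventually (eventually_turns_coe h.1.2 h.2.2)] with θ hθ
    rw [← coe_toCircle_coe_zpow, transition, toThetaTorus, hθ]
  refine (ContDiffAt.congr_of_eventuallyEq ?_ hev).contDiffWithinAt
  exact (((contDiff_const.mul (Complex.ofRealCLM.contDiff.comp contDiff_fst)).mul
    contDiff_const).cexp).contDiffAt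

theorem partial₁_transition (k : ℤ) (a b : ℝ × ℝ) (t : ThetaTorus) :
    partial₁ (transition k a b) t
      = (k * turns a.2 b.2 t.2 : ℤ) * Complex.I * transition k a b t := by
  set n := k * turns a.2 b.2 t.2 with hn
  have h : (fun r : ℝ => transition k a b (t.1 + (r : Real.Angle), t.2))
      = fun r : ℝ => transition k a b t * Complex.exp (n * r * Complex.I) := by
    funext r
    rw [transition, transition, Real.Angle.toCircle_add, Circle.coe_mul, mul_zpow, ← hn,
      coe_toCircle_coe_zpow]
  rw [partial₁, h]
  have h1 : HasDerivAt (fun r : ℝ => (n * r * Complex.I : ℂ)) (n * 1 * Complex.I) 0 :=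
    ((Complex.ofRealCLM.hasDerivAt (x := 0)).const_mul _).mul_const _
  rw [(h1.cexp.const_mul _).deriv]
  simp
  ring

theorem partial₂_transition (k : ℤ) {a b : ℝ × ℝ} {t : ThetaTorus}
    (ht : t ∈ chartDomain a ∩ chartDomain b) : partial₂ (transition k a b) t = 0 := by
  have h : (fun r : ℝ => transition k a b (t.1, t.2 + (r : Real.Angle))) =ᶠ[nhds 0]
      fun _ => transition k a b t := by
    filter_upwards [eventually_turns_add ht.1.2 ht.2.2] with r hr
    rw [transition, transition, hr]
  rw [partial₂, h.deriv_eq, deriv_const]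

/-- The coefficient of `dθ₁` in the connection form `(i k θ₂ / 2π) dθ₁`, in the chart based at
`a`. -/
def connectionCoeff (k : ℤ) (a : ℝ × ℝ) (t : ThetaTorus) : ℂ :=
  Complex.I * k / (2 * Real.pi) * angleLift a.2 t.2

theorem smoothOn_connectionCoeff (k : ℤ) (a : ℝ × ℝ) :
    SmoothOn (connectionCoeff k a) (chartDomain a) := by
  intro θ₀ h
  have hev : (fun θ : ℝ × ℝ => connectionCoeff k a (toThetaTorus θ)) =ᶠ[nhds θ₀]
      fun θ => Complex.I * k / (2 * Real.pi) *
        ((angleLift a.2 θ₀.2 + (θ.2 - θ₀.2) : ℝ) : ℂ) := by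
    filter_upwards [continuousAt_snd.eventually (eventually_angleLift_coe h.2)] with θ hθ
    rw [connectionCoeff, toThetaTorus, hθ]
  refine (ContDiffAt.congr_of_eventuallyEq ?_ hev).contDiffWithinAt
  exact (contDiff_const.mul (Complex.ofRealCLM.contDiff.comp
    (contDiff_const.add (contDiff_snd.sub contDiff_const)))).contDiffAt

theorem partial₂_connectionCoeff (k : ℤ) {a : ℝ × ℝ} {t : ThetaTorus} (ht : t ∈ chartDomain a) :
    partial₂ (connectionCoeff k a) t = Complex.I * k / (2 * Real.pi) := by
  have h : (fun r : ℝ => connectionCoeff k a (t.1, t.2 + (r : Real.Angle))) =ᶠ[nhds 0]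
      fun r => Complex.I * k / (2 * Real.pi) * ((angleLift a.2 t.2 + r : ℝ) : ℂ) := by
    filter_upwards [eventually_angleLift_add ht.2] with r hr
    rw [connectionCoeff, hr]
  have h1 : HasDerivAt (fun r : ℝ => angleLift a.2 t.2 + r) 1 0 := (hasDerivAt_id 0).const_add _
  rw [partial₂, h.deriv_eq, (h1.ofReal_comp.const_mul _).deriv, Complex.ofReal_one, mul_one]

theorem connectionCoeff_eq_add (k : ℤ) (a b : ℝ × ℝ) (t : ThetaTorus) :
    connectionCoeff k b t
      = connectionCoeff k a t + partial₁ (transition k a b) t / transition k a b t := by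
  have hpi : (Real.pi : ℂ) ≠ 0 := by exact_mod_cast Real.pi_ne_zero
  rw [partial₁_transition, mul_div_cancel_right₀ _ (transition_ne_zero k a b t), connectionCoeff,
    connectionCoeff, angleLift_eq_add_turns a.2 b.2]
  push_cast
  field_simp

theorem CylMotion.frame_eq_transition_smul (ψ : CylMotion N k) (a b : ℝ × ℝ) (t : ThetaTorus) :
    ψ.proj (torusLift b t) = transition k a b t • ψ.proj (torusLift a t) := by
  have h : torusLift b t = ((torusLift a t).1 + turns a.1 b.1 t.1 * (2 * Real.pi),
      (torusLift a t).2 + turns a.2 b.2 t.2 * (2 * Real.pi)) :=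
    Prod.ext (angleLift_eq_add_turns _ _ _) (angleLift_eq_add_turns _ _ _)
  rw [h, ψ.proj_add_int, transition, ← coe_angleLift a.1 t.1, coe_toCircle_coe_zpow]
  push_cast
  rfl

/-- The connection with `∇ψ̃ = (i k θ₂ / 2π) dθ₁ ⊗ ψ̃` on the plane. It descends to the torus since
`ψ̃(θ₁, θ₂ + 2π) = exp (i k θ₁) ψ̃(θ₁, θ₂)`. -/
def CylMotion.connection (ψ : CylMotion N k) (hψ : ∀ θ, ψ.proj θ ≠ 0) : Connection ψ.line where
  ι := ℝ × ℝ
  U := chartDomain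
  isOpen_U := isOpen_chartDomain
  cover := exists_mem_chartDomain
  s a t := ψ.proj (torusLift a t)
  s_cont := ψ.continuousOn_frame
  s_ne_zero _ _ _ := hψ _
  s_span a t _ := ψ.line_eq_span a t
  g := transition k
  g_smooth := smoothOn_transition k
  s_eq a b t _ := ψ.frame_eq_transition_smul a b t
  a₁ := connectionCoeff k
  a₂ _ _ := 0
  a₁_smooth := smoothOn_connectionCoeff k
  a₂_smooth _ := contDiffOn_const
  a₁_eq a b t _ := connectionCoeff_eq_add k a b t
  a₂_eq a b t ht := by rw [partial₂_transition k ht, zero_div, add_zero]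
  curv _ := -(Complex.I * k / (2 * Real.pi))
  curv_eq a t ht := by
    rw [partial₂_connectionCoeff k ht, partial₁, deriv_const, zero_sub]

theorem CylMotion.hasChernIndex_line (ψ : CylMotion N k) (hψ : ∀ θ, ψ.proj θ ≠ 0) :
    HasChernIndex ψ.line k := by
  refine ⟨ψ.connection hψ, ?_⟩
  have hpi : (Real.pi : ℂ) ≠ 0 := by exact_mod_cast Real.pi_ne_zero
  simp only [CylMotion.connection, intervalIntegral.integral_const, sub_zero, Complex.real_smul]
  push_cast
  field_simp
  rw [Complex.I_sq]
  ring

end TorusQuantum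

end

theorem mainTheorem1 (N : ℕ) (hN : 4 ≤ N) (k : ℤ) :
    -- the series defining `P_{θ₁}` converges
    (∀ (ψ : TorusQuantum.CylMotion N k) (θ : ℝ × ℝ),
      Summable fun n : ℤ =>
        Complex.exp (-(n * θ.1 * Complex.I)) • (TorusQuantum.TQ ^ n) (ψ.state θ.2)) ∧
    -- a generic motion has a nowhere vanishing projection
    IsOpen {ψ : TorusQuantum.CylMotion N k | ∀ θ : ℝ × ℝ, ψ.proj θ ≠ 0} ∧
    Dense {ψ : TorusQuantum.CylMotion N k | ∀ θ : ℝ × ℝ, ψ.proj θ ≠ 0} ∧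
    -- for such a motion, the projection is a section of a line bundle of Chern index `k`
    ∀ ψ : TorusQuantum.CylMotion N k, (∀ θ : ℝ × ℝ, ψ.proj θ ≠ 0) →
      Continuous ψ.proj ∧
      ∃ L : TorusQuantum.ThetaTorus → Submodule ℂ (TemperedDistribution ℝ ℂ),
        TorusQuantum.IsLineSubbundle N L ∧
        (∀ θ : ℝ × ℝ, L (TorusQuantum.toThetaTorus θ) = Submodule.span ℂ {ψ.proj θ}) ∧
        TorusQuantum.HasChernIndex L k :=
  ⟨fun _ θ => (TorusQuantum.hasSum_projState N θ _).summable,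
    TorusQuantum.CylMotion.isOpen_forall_proj_ne_zero,
    TorusQuantum.CylMotion.dense_forall_proj_ne_zero (by omega),
    fun ψ hψ => ⟨ψ.continuous_proj, ψ.line, ψ.isLineSubbundle_line (by omega) hψ,
      ψ.line_toThetaTorus, ψ.hasChernIndex_line hψ⟩⟩
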